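/- Let $p\ge 1$, $n\ge p+3$ and $0\le \ell\le p-1$ be integers, let $M^n$ be a smooth $n$-dimensional manifold and let $f\colon M^n\to\mathbb{R}^{n+p}$ be a smooth immersion with induced metric $\langle\,,\,\rangle_f$, Levi-Civita connection ${}^f\nabla$, normal connection $\nabla^\perp$, second fundamental form $\alpha$ and mean curvature vector field $\mathcal{H}=\frac1n\operatorname{tr}\alpha$. For a normal vector $\zeta$ at $x$ put $E_\zeta(x)=\{X\in T_xM:\alpha(X,Y)=\langle X,Y\rangle_f\,\zeta\ \text{for all } Y\in T_xM\}$; $\zeta$ is a principal normal vector at $x$ if $\dim E_\zeta(x)>0$. Assume that - $f$ has flat normal bundle and is proper, i.e. the number of distinct principal normal vectors at $x$ is the same for all $x\in M$; - $(M^n,\langle\,,\,\rangle_f)$ is conformally flat, i.e. every point has a neighborhood conformally diffeomorphic to an open subset of $\mathbb{R}^n$; - $\eta$ is a smooth normal vector field of $f$ that is a principal normal vector field with multiplicity $n-p+\ell$, i.e. $\dim E_\eta(x)=n-p+\ell$ for all $x\in M$. (Since $2\le n-p+\ell<n$, such an $f$ has no umbilical points.) Let $\rho>0$ be given by $\rho^2=\frac{n}{n-1}\left(\|\alpha\|^2-n\|\mathcal{H}\|^2\right)$,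 let $\langle\,,\,\rangle^*=\rho^2\langle\,,\,\rangle_f$ be the Moebius metric, with gradient $\operatorname{grad}^*$, and let $\beta=\rho\,(\alpha-\langle\,,\,\rangle_f\mathcal{H})$. Assume moreover that the Moebius form $$\omega(X)=-\tfrac1\rho\left(\nabla^\perp_X\mathcal{H}+\beta(X,\operatorname{grad}^*\rho)\right)$$ is closed, i.e. $\nabla^\perp_X\omega(Y)-\nabla^\perp_Y\omega(X)-\omega([X,Y])=0$ for all smooth vector fields $X,Y$. Let $\Delta=E_\eta$ and let $\Delta^\perp$ be its orthogonal complement. A distribution $E$ on a Riemannian manifold is called umbilical with mean curvature vector field $\delta$ if $\delta$ is a smooth section of $E^\perp$ and $\langle\nabla_TS,X\rangle=\langle T,S\rangle\langle\delta,X\rangle$ for all $T,S\in\Gamma(E)$, $X\in\Gamma(E^\perp)$; it is totally geodesic if this holds with $\delta=0$, and spherical if in addition to being umbilical it satisfies $(\nabla_T\delta)_{E^\perp}=0$ for all $T\in\Gamma(E)$. If $\Delta^\perp$ is totally geodesic with respect to $\langle\,,\,\rangle^*$, then $\Delta^\perp$ is a smooth distribution that is spherical with respect to $\langle\,,\,\rangle_f$,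 with mean curvature vector field $(\operatorname{grad}_f\log\rho)_\Delta$, the $\Delta$-component of the gradient of $\log\rho$ with respect to $\langle\,,\,\rangle_f$. -/

import Mathlib

open scoped Manifold ContDiff Topology
open Bundle VectorField

noncomputable section

namespace MoebiusGeometry

section Intrinsic

variable {n : ℕ} {M : Type*} [TopologicalSpace M]
  [ChartedSpace (EuclideanSpace ℝ (Fin n)) M]

/-! ### Vector fields, metrics and distributions on an `n`-dimensional manifold -/

/-- (Not necessarily smooth) vector fields on `M`. -/
abbrev VField (n : ℕ) (M : Type*) [TopologicalSpace M]
    [ChartedSpace (EuclideanSpace ℝ (Fin n)) M] : Type _ :=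
  ∀ x : M, TangentSpace (𝓡 n) x

/-- A bilinear form on every tangent space of `M`. -/
abbrev MetricField (n : ℕ) (M : Type*) [TopologicalSpace M]
    [ChartedSpace (EuclideanSpace ℝ (Fin n)) M] : Type _ :=
  ∀ x : M, LinearMap.BilinForm ℝ (TangentSpace (𝓡 n) x)

/-- A linear subspace of every tangent space of `M`. -/
abbrev TangentDistribution (n : ℕ) (M : Type*) [TopologicalSpace M]
    [ChartedSpace (EuclideanSpace ℝ (Fin n)) M] : Type _ :=
  ∀ x : M, Submodule ℝ (TangentSpace (𝓡 n) x)

/-- The derivative `X(u)` of a function `u` with values in a normed space in the direction of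
the vector field `X`. -/
def dirDeriv {F : Type*} [NormedAddCommGroup F] [NormedSpace ℝ F] (X : VField n M) (u : M → F) :
    M → F :=
  fun x => mvfderiv (𝓡 n) u x (X x)

/-- The vector field `X` is smooth. -/
def IsSmoothField [IsManifold (𝓡 n) ∞ M] (X : VField n M) : Prop :=
  ContMDiff (𝓡 n) (𝓡 n).tangent ∞ (fun x => (⟨x, X x⟩ : TangentBundle (𝓡 n) M))

/-- `X ∈ Γ(E)`: `X` is a smooth vector field with values in `E`. -/
def IsSectionOf [IsManifold (𝓡 n) ∞ M] (X : VField n M) (E : TangentDistribution n M) : Prop :=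
  IsSmoothField X ∧ ∀ x, X x ∈ E x

/-- `E` is a smooth distribution: it has constant rank and is locally spanned by a frame of
smooth vector fields. -/
def IsSmoothDistribution [IsManifold (𝓡 n) ∞ M] (E : TangentDistribution n M) : Prop :=
  ∃ k : ℕ, ∀ x : M, ∃ X : Fin k → VField n M, (∀ i, IsSmoothField (X i)) ∧
    ∀ᶠ y in 𝓝 x, LinearIndependent ℝ (fun i => X i y) ∧
      Submodule.span ℝ (Set.range fun i => X i y) = E y

/-- The orthogonal complement `Eᗮ` of the distribution `E` with respect to `g`. -/
def orth (g : MetricField n M) (E : TangentDistribution n M) : TangentDistribution n M :=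
  fun x => (g x).orthogonal (E x)

/-- The component in `W` of the tangent vector `v` at `x`: the vector of `W` for which
`v` minus this vector is `g`-orthogonal to `W`. -/
def component (g : MetricField n M) {x : M} (W : Submodule ℝ (TangentSpace (𝓡 n) x))
    (v : TangentSpace (𝓡 n) x) : TangentSpace (𝓡 n) x :=
  Classical.epsilon fun u => u ∈ W ∧ ∀ w ∈ W, g x (v - u) w = 0

/-- The gradient of `u` with respect to `g`: the vector field with `g(grad u, w) = du(w)` for
all tangent vectors `w`. -/
def grad (g : MetricField n M) (u : M → ℝ) : VField n M :=
  fun x => Classical.epsilon fun v => ∀ w, g x v w = mvfderiv (𝓡 n) u x w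

/-- A basis of the tangent space at `x` that is orthonormal for `g`. -/
def orthonormalFrame (g : MetricField n M) (x : M) : Fin n → TangentSpace (𝓡 n) x :=
  Classical.epsilon fun e => ∀ i j, g x (e i) (e j) = if i = j then 1 else 0

/-- The right-hand side of the Koszul formula for `2 g(∇_X Y, Z)`. -/
def koszul (g : MetricField n M) (X Y Z : VField n M) (x : M) : ℝ :=
  dirDeriv X (fun y => g y (Y y) (Z y)) x + dirDeriv Y (fun y => g y (X y) (Z y)) x
    - dirDeriv Z (fun y => g y (X y) (Y y)) x
    + g x (mlieBracket (𝓡 n) X Y x) (Z x)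
    - g x (mlieBracket (𝓡 n) X Z x) (Y x)
    - g x (mlieBracket (𝓡 n) Y Z x) (X x)

/-- The covariant derivative `∇_X Y` of the Levi-Civita connection of `g`, given by the Koszul
formula. -/
def leviCivita [IsManifold (𝓡 n) ∞ M] (g : MetricField n M) (X Y : VField n M) : VField n M :=
  fun x => Classical.epsilon fun v =>
    ∀ Z : VField n M, IsSmoothField Z → 2 * g x v (Z x) = koszul g X Y Z x

/-- With respect to the metric `g`, the distribution `E` is umbilical with mean curvature vector
field `δ`. -/
def IsUmbilicalWith [IsManifold (𝓡 n) ∞ M] (g : MetricField n M) (E : TangentDistribution n M)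
    (δ : VField n M) : Prop :=
  IsSectionOf δ (orth g E) ∧
    ∀ T S X : VField n M, IsSectionOf T E → IsSectionOf S E → IsSectionOf X (orth g E) →
      ∀ x, g x (leviCivita g T S x) (X x) = g x (T x) (S x) * g x (δ x) (X x)

/-- The distribution `E` is totally geodesic with respect to the metric `g`. -/
def IsTotallyGeodesic [IsManifold (𝓡 n) ∞ M] (g : MetricField n M) (E : TangentDistribution n M) :
    Prop :=
  IsUmbilicalWith g E 0

/-- With respect to the metric `g`, the distribution `E` is spherical with mean curvature vector
field `δ`. -/
def IsSphericalWith [IsManifold (𝓡 n) ∞ M] (g : MetricField n M) (E : TangentDistribution n M)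
    (δ : VField n M) : Prop :=
  IsUmbilicalWith g E δ ∧
    ∀ T : VField n M, IsSectionOf T E →
      ∀ x, component g (orth g E x) (leviCivita g T δ x) = 0

/-- `(M, g)` is conformally flat: each point has a neighbourhood that is conformally
diffeomorphic to an open subset of Euclidean space. -/
def IsConformallyFlat (g : MetricField n M) : Prop :=
  ∀ x : M, ∃ φ : OpenPartialHomeomorph M (EuclideanSpace ℝ (Fin n)), x ∈ φ.source ∧
    ContMDiffOn (𝓡 n) (𝓡 n) ∞ φ φ.source ∧ ContMDiffOn (𝓡 n) (𝓡 n) ∞ φ.symm φ.target ∧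
    ∀ y ∈ φ.source, ∃ c : ℝ, 0 < c ∧ ∀ v w : TangentSpace (𝓡 n) y,
      inner ℝ (mvfderiv (𝓡 n) φ y v) (mvfderiv (𝓡 n) φ y w) = c * g y v w

end Intrinsic

section Extrinsic

variable {n m : ℕ} {M : Type*} [TopologicalSpace M]
  [ChartedSpace (EuclideanSpace ℝ (Fin n)) M]

/-! ### Immersions into Euclidean space -/

/-- `f` is a smooth immersion. -/
def IsSmoothImmersion (f : M → EuclideanSpace ℝ (Fin m)) : Prop :=
  ContMDiff (𝓡 n) (𝓡 m) ∞ f ∧ ∀ x, Function.Injective (mvfderiv (𝓡 n) f x)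

/-- The metric `⟨v, w⟩_f = ⟨f_* v, f_* w⟩` induced by `f`. -/
def inducedMetric (f : M → EuclideanSpace ℝ (Fin m)) : MetricField n M :=
  fun x => (innerₗ (EuclideanSpace ℝ (Fin m))).compl₁₂
    (mvfderiv (𝓡 n) f x).toLinearMap (mvfderiv (𝓡 n) f x).toLinearMap

/-- The normal space `N_f M(x)`. -/
def normalSpace (f : M → EuclideanSpace ℝ (Fin m)) (x : M) :
    Submodule ℝ (EuclideanSpace ℝ (Fin m)) :=
  (LinearMap.range (mvfderiv (𝓡 n) f x).toLinearMap)ᗮ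

/-- A smooth normal vector field along `f`. -/
def IsNormalField (f ξ : M → EuclideanSpace ℝ (Fin m)) : Prop :=
  ContMDiff (𝓡 n) (𝓡 m) ∞ ξ ∧ ∀ x, ξ x ∈ normalSpace (n := n) f x

/-- The normal connection `∇^⊥_X ξ`: the normal component of the derivative of `ξ` along `X`. -/
def normalConnection (f : M → EuclideanSpace ℝ (Fin m)) (X : VField n M)
    (ξ : M → EuclideanSpace ℝ (Fin m)) : M → EuclideanSpace ℝ (Fin m) :=
  fun x => (normalSpace (n := n) f x).starProjection (dirDeriv X ξ x)

/-- The normal bundle of `f` is flat: the curvature tensor of the normal connection vanishes. -/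
def HasFlatNormalBundle [IsManifold (𝓡 n) ∞ M] (f : M → EuclideanSpace ℝ (Fin m)) : Prop :=
  ∀ (X Y : VField n M) (ξ : M → EuclideanSpace ℝ (Fin m)),
    IsSmoothField X → IsSmoothField Y → IsNormalField (n := n) f ξ → ∀ x,
      normalConnection f X (normalConnection f Y ξ) x
        - normalConnection f Y (normalConnection f X ξ) x
        - normalConnection f (mlieBracket (𝓡 n) X Y) ξ x = 0

/-- The second fundamental form `α^f(v, w)` at `x` (Gauss formula): the normal component of the
derivative in direction `v` of `f_* W`, where `W` is the vector field near `x` that extends `w`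
and is constant in the chart at `x`. -/
def secondForm [IsManifold (𝓡 n) ∞ M] (f : M → EuclideanSpace ℝ (Fin m)) (x : M)
    (v w : TangentSpace (𝓡 n) x) : EuclideanSpace ℝ (Fin m) :=
  (normalSpace (n := n) f x).starProjection
    (mvfderiv (𝓡 n) (fun y => mvfderiv (𝓡 n) f y
      (FiberBundle.extend (EuclideanSpace ℝ (Fin n)) w y)) x v)

/-- `E_ζ(x) = {v : α^f(v, w) = ⟨v, w⟩ ζ for all w}`. -/
def principalSpace [IsManifold (𝓡 n) ∞ M] (f : M → EuclideanSpace ℝ (Fin m)) (x : M)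
    (ζ : EuclideanSpace ℝ (Fin m)) : Submodule ℝ (TangentSpace (𝓡 n) x) where
  carrier := {v | ∀ w, secondForm f x v w = inducedMetric f x v w • ζ}
  zero_mem' := by intro w; simp [secondForm]
  add_mem' := by
    intro a b ha hb w
    have h : secondForm f x (a + b) w = secondForm f x a w + secondForm f x b w := by
      simp [secondForm]
    rw [h, ha w, hb w, map_add, LinearMap.add_apply, add_smul]
  smul_mem' := by
    intro c a ha w
    have h : secondForm f x (c • a) w = c • secondForm f x a w := by
      simp [secondForm]
    rw [h, ha w, map_smul, LinearMap.smul_apply, smul_eq_mul, mul_smul]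

/-- The set of principal normal vectors of `f` at `x`. -/
def principalNormals [IsManifold (𝓡 n) ∞ M] (f : M → EuclideanSpace ℝ (Fin m)) (x : M) :
    Set (EuclideanSpace ℝ (Fin m)) :=
  {ζ | ζ ∈ normalSpace (n := n) f x ∧ 0 < Module.finrank ℝ (principalSpace (n := n) f x ζ)}

/-- The number of distinct principal normal vectors of `f` does not depend on the point. -/
def IsProperImmersion [IsManifold (𝓡 n) ∞ M] (f : M → EuclideanSpace ℝ (Fin m)) : Prop :=
  ∃ k : ℕ, ∀ x : M, (principalNormals (n := n) f x).encard = k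

/-- `η` is a principal normal vector field of `f` with multiplicity `s`. -/
def IsPrincipalNormalField [IsManifold (𝓡 n) ∞ M] (f η : M → EuclideanSpace ℝ (Fin m))
    (s : ℕ) : Prop :=
  IsNormalField (n := n) f η ∧ 0 < s ∧
    ∀ x : M, Module.finrank ℝ (principalSpace (n := n) f x (η x)) = s

/-! ### Moebius invariants -/

/-- The mean curvature vector field `ℋ^f = (1/n) tr α^f`. -/
def meanCurvature [IsManifold (𝓡 n) ∞ M] (f : M → EuclideanSpace ℝ (Fin m)) :
    M → EuclideanSpace ℝ (Fin m) :=
  fun x => (n : ℝ)⁻¹ • ∑ i : Fin n, secondForm f x (orthonormalFrame (inducedMetric f) x i)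
    (orthonormalFrame (inducedMetric f) x i)

/-- `‖α^f‖²` at `x`. -/
def secondFormNormSq [IsManifold (𝓡 n) ∞ M] (f : M → EuclideanSpace ℝ (Fin m)) (x : M) : ℝ :=
  ∑ i : Fin n, ∑ j : Fin n, ‖secondForm f x (orthonormalFrame (n := n) (inducedMetric f) x i)
    (orthonormalFrame (n := n) (inducedMetric f) x j)‖ ^ 2

/-- The function `ρ ≥ 0` with `ρ² = n/(n-1) (‖α^f‖² - n ‖ℋ^f‖²)`. -/
def moebiusFactor [IsManifold (𝓡 n) ∞ M] (f : M → EuclideanSpace ℝ (Fin m)) : M → ℝ :=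
  fun x => √((n : ℝ) / ((n : ℝ) - 1) *
    (secondFormNormSq (n := n) f x - (n : ℝ) * ‖meanCurvature (n := n) f x‖ ^ 2))

/-- The Moebius metric `⟨ , ⟩* = ρ² ⟨ , ⟩_f`. -/
def moebiusMetric [IsManifold (𝓡 n) ∞ M] (f : M → EuclideanSpace ℝ (Fin m)) :
    MetricField n M :=
  fun x => (moebiusFactor (n := n) f x ^ 2) • inducedMetric f x

/-- The Moebius second fundamental form `β(v, w) = ρ (α^f(v, w) - ⟨v, w⟩ ℋ^f)`. -/
def moebiusSecondForm [IsManifold (𝓡 n) ∞ M] (f : M → EuclideanSpace ℝ (Fin m)) (x : M)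
    (v w : TangentSpace (𝓡 n) x) : EuclideanSpace ℝ (Fin m) :=
  moebiusFactor (n := n) f x •
    (secondForm f x v w - inducedMetric f x v w • meanCurvature (n := n) f x)

/-- The Moebius form `ω(X) = -ρ⁻¹ (∇^⊥_X ℋ^f + β(X, grad* ρ))`. -/
def moebiusForm [IsManifold (𝓡 n) ∞ M] (f : M → EuclideanSpace ℝ (Fin m)) (X : VField n M) :
    M → EuclideanSpace ℝ (Fin m) :=
  fun x => -((moebiusFactor (n := n) f x)⁻¹ •
    (normalConnection f X (meanCurvature (n := n) f) x
      + moebiusSecondForm f x (X x) (grad (moebiusMetric f) (moebiusFactor (n := n) f) x)))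

/-- The Moebius form of `f` is closed:
`dω(X, Y) = ∇^⊥_X ω(Y) - ∇^⊥_Y ω(X) - ω([X, Y])` vanishes. -/
def HasClosedMoebiusForm [IsManifold (𝓡 n) ∞ M] (f : M → EuclideanSpace ℝ (Fin m)) : Prop :=
  ∀ X Y : VField n M, IsSmoothField X → IsSmoothField Y → ∀ x,
    normalConnection f X (moebiusForm f Y) x - normalConnection f Y (moebiusForm f X) x
      - moebiusForm f (mlieBracket (𝓡 n) X Y) x = 0

/-- The distribution `E_η` of a normal vector field `η`. -/
def principalDistribution [IsManifold (𝓡 n) ∞ M] (f η : M → EuclideanSpace ℝ (Fin m)) :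
    TangentDistribution n M :=
  fun x => principalSpace f x (η x)

end Extrinsic

end MoebiusGeometry

end

open MoebiusGeometry

/-! Write φ = 1/ρ and let D be the flat derivative of the ambient space. Since grad* ρ = -grad φ,
the Moebius form is the normal derivative of G = f_* grad φ - φℋ (`moebiusForm_eq`). For any
ambient-valued map G, the second normal derivatives of G commute up to α(Y, (D_X G)ᵀ) - α(X, (D_Y
G)ᵀ) (`normalConnection_curvature`). For G this vanishes because ω is closed, for the normal field
φℋ because the normal bundle is flat. Subtracting gives α(Y, ∇_X grad φ) = α(X, ∇_Y grad φ)
(`secondForm_hessian_comm`), so Hess φ maps Δ = E_η into itself (`hessian_mem_principal`) and Hess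
φ(T, W) = 0 for T in Δᗮ, W in Δ.

The Koszul formula under the conformal change ρ²⟨ , ⟩_f turns total geodesy of Δᗮ into ⟨∇_T S, W⟩ =
⟨T, S⟩ W(log ρ), that is, umbilicity with δ = (grad log ρ)_Δ (`umbilical_of_totallyGeodesic`). Since
grad φ = -φ grad log ρ, the field grad φ + φδ lies in Δᗮ. Putting it in place of S gives T(φ)⟨δ, W⟩
on the right; on the left the Hessian term drops out and φ⟨∇_T δ, W⟩ + T(φ)⟨δ, W⟩ remains. Hence
⟨∇_T δ, W⟩ = 0, which is sphericity (`isSpherical_orth_principal`).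

Smoothness of Δᗮ comes from the smooth tensor α - ⟨ , ⟩η, whose kernel is Δ
(`exists_orth_principal_section`). -/

namespace MoebiusGeometry

/-! ### Smooth fields, directional derivatives and brackets on a manifold. -/

section Calculus

variable {n : ℕ} {M : Type*} [TopologicalSpace M]
  [ChartedSpace (EuclideanSpace ℝ (Fin n)) M] [IsManifold (𝓡 n) ∞ M]
  {F : Type*} [NormedAddCommGroup F] [NormedSpace ℝ F]

theorem IsSmoothField.mdifferentiableAt {X : VField n M} (hX : IsSmoothField X) (x : M) :
    MDifferentiableAt (𝓡 n) (𝓡 n).tangent (fun y => (⟨y, X y⟩ : TangentBundle (𝓡 n) M)) x :=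
  (hX x).mdifferentiableAt (by simp)

theorem isSmoothField_of_local {X : VField n M}
    (h : ∀ x, ∃ Y : VField n M, IsSmoothField Y ∧ ∀ᶠ y in 𝓝 x, X y = Y y) : IsSmoothField X := by
  intro x
  obtain ⟨Y, hY, hXY⟩ := h x
  refine (hY x).congr_of_eventuallyEq ?_
  filter_upwards [hXY] with y hy
  rw [hy]

omit [IsManifold (𝓡 n) ∞ M] in
theorem contMDiff_of_local {h : M → F}
    (H : ∀ x, ∃ k : M → F, ContMDiff (𝓡 n) 𝓘(ℝ, F) ∞ k ∧ ∀ᶠ y in 𝓝 x, h y = k y) :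
    ContMDiff (𝓡 n) 𝓘(ℝ, F) ∞ h := by
  intro x
  obtain ⟨k, hk, hhk⟩ := H x
  exact (hk x).congr_of_eventuallyEq hhk

theorem IsSmoothField.add {X Y : VField n M} (hX : IsSmoothField X) (hY : IsSmoothField Y) :
    IsSmoothField (fun x => X x + Y x) := ContMDiff.add_section hX hY

theorem IsSmoothField.sub {X Y : VField n M} (hX : IsSmoothField X) (hY : IsSmoothField Y) :
    IsSmoothField (fun x => X x - Y x) := ContMDiff.sub_section hX hY

theorem IsSmoothField.smul {X : VField n M} {c : M → ℝ} (hc : ContMDiff (𝓡 n) 𝓘(ℝ) ∞ c)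
    (hX : IsSmoothField X) : IsSmoothField (fun x => c x • X x) := ContMDiff.smul_section hc hX

theorem IsSmoothField.sum {ι : Type*} {s : Finset ι} {X : ι → VField n M}
    (hX : ∀ i ∈ s, IsSmoothField (X i)) : IsSmoothField (fun x => ∑ i ∈ s, X i x) :=
  ContMDiff.sum_section hX

theorem isSmoothField_zero : IsSmoothField (0 : VField n M) :=
  contMDiff_zeroSection ℝ (TangentSpace (𝓡 n) : M → Type _)

theorem dirDeriv_contMDiff {X : VField n M} (hX : IsSmoothField X) {h : M → F}
    (hh : ContMDiff (𝓡 n) 𝓘(ℝ, F) ∞ h) : ContMDiff (𝓡 n) 𝓘(ℝ, F) ∞ (dirDeriv X h) := by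
  have h1 : ContMDiff (𝓡 n).tangent 𝓘(ℝ, F).tangent ∞ (tangentMap (𝓡 n) 𝓘(ℝ, F) h) :=
    hh.contMDiff_tangentMap (by simp)
  have h2 := (contMDiff_snd_tangentBundle_modelSpace F 𝓘(ℝ, F) (n := ∞)).comp (h1.comp hX)
  exact h2

omit [IsManifold (𝓡 n) ∞ M] in
theorem mvfderiv_congr {h k : M → F} {x : M} (H : h =ᶠ[𝓝 x] k) :
    mvfderiv (𝓡 n) h x = mvfderiv (𝓡 n) k x := by
  have : mfderiv (𝓡 n) 𝓘(ℝ, F) h x = mfderiv (𝓡 n) 𝓘(ℝ, F) k x := H.mfderiv_eq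
  ext v
  exact congrArg (fun L => L v) this

theorem mvfderiv_comp_extChartAt {x y : M} (hy : y ∈ (extChartAt (𝓡 n) x).source)
    {K : EuclideanSpace ℝ (Fin n) → F} (hK : DifferentiableAt ℝ K (extChartAt (𝓡 n) x y))
    (w : EuclideanSpace ℝ (Fin n)) :
    mvfderiv (𝓡 n) (K ∘ extChartAt (𝓡 n) x) y
      ((mfderiv (𝓡 n) 𝓘(ℝ, EuclideanSpace ℝ (Fin n)) (extChartAt (𝓡 n) x) y).inverse w)
      = fderiv ℝ K (extChartAt (𝓡 n) x y) w := by
  have : IsManifold (𝓡 n) 1 M := IsManifold.of_le (n := ∞) (by norm_cast)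
  have hi := isInvertible_mfderiv_extChartAt (I := 𝓡 n) hy
  have h1 : mfderiv (𝓡 n) 𝓘(ℝ, F) (K ∘ extChartAt (𝓡 n) x) y = _ :=
    mfderiv_comp (I' := 𝓘(ℝ, EuclideanSpace ℝ (Fin n))) y hK.mdifferentiableAt
      (mdifferentiableAt_extChartAt (by simpa using hy))
  rw [mfderiv_eq_fderiv] at h1
  have h2 := congrArg (fun L => L ((mfderiv (𝓡 n) 𝓘(ℝ, EuclideanSpace ℝ (Fin n))
    (extChartAt (𝓡 n) x) y).inverse w)) h1
  refine h2.trans ?_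
  exact congrArg (fderiv ℝ K (extChartAt (𝓡 n) x y)) (hi.self_apply_inverse w)

/-- In the chart at `x` this is the symmetry of the second derivative. Applied to the immersion
itself it says D_X f_*Y - D_Y f_*X = f_*[X, Y], the source of the symmetry of α, of the Koszul
computation and of the symmetry of the Hessian. -/
theorem bracket_dirDeriv {X Y : VField n M} {x : M}
    (hX : MDifferentiableAt (𝓡 n) (𝓡 n).tangent (fun y => (⟨y, X y⟩ : TangentBundle (𝓡 n) M)) x)
    (hY : MDifferentiableAt (𝓡 n) (𝓡 n).tangent (fun y => (⟨y, Y y⟩ : TangentBundle (𝓡 n) M)) x)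
    {h : M → F} (hh : ContMDiff (𝓡 n) 𝓘(ℝ, F) ∞ h) :
    mvfderiv (𝓡 n) h x (mlieBracket (𝓡 n) X Y x)
      = dirDeriv X (dirDeriv Y h) x - dirDeriv Y (dirDeriv X h) x := by
  have : IsManifold (𝓡 n) 2 M := IsManifold.of_le (n := ∞) (by norm_cast)
  set φ := extChartAt (𝓡 n) x with hφ
  set k : EuclideanSpace ℝ (Fin n) → F := h ∘ φ.symm with hk
  set pull : VField n M → EuclideanSpace ℝ (Fin n) → EuclideanSpace ℝ (Fin n) := fun V =>
    mpullbackWithin 𝓘(ℝ, EuclideanSpace ℝ (Fin n)) (𝓡 n) φ.symm V (Set.range (𝓡 n)) with hpull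
  have hkx : ContDiffAt ℝ ∞ k (φ x) := by
    have := (hh x)
    rw [contMDiffAt_iff] at this
    have h2 := this.2
    rw [ModelWithCorners.range_eq_univ, contDiffWithinAt_univ] at h2
    exact h2
  have hkd : ∀ᶠ z in 𝓝 (φ x), DifferentiableAt ℝ k z := by
    have : ContDiffAt ℝ 1 k (φ x) := hkx.of_le (by norm_cast)
    filter_upwards [this.eventually (by simp)] with z hz
    exact hz.differentiableAt (by simp)
  have hpullV : ∀ V : VField n M, ∀ᶠ y in 𝓝 x,
      V y = (mfderiv (𝓡 n) 𝓘(ℝ, EuclideanSpace ℝ (Fin n)) φ y).inverse (pull V (φ y)) := by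
    intro V
    have h1 := eventuallyEq_mpullback_mpullbackWithin_extChartAt (I := 𝓡 n) (s := Set.univ)
      (x := x) V
    rw [nhdsWithin_univ] at h1
    exact h1
  have hxs : x ∈ φ.source := mem_extChartAt_source x
  have hkφ : ∀ᶠ y in 𝓝 x, h y = (k ∘ φ) y := by
    filter_upwards [extChartAt_source_mem_nhds (I := 𝓡 n) x] with y hy
    simp [hk, φ.left_inv hy]
  -- The identity is needed on a neighbourhood, not only at `x`, since it is differentiated once
  -- more.
  have key : ∀ V : VField n M, dirDeriv V h =ᶠ[𝓝 x] (fun z => fderiv ℝ k z (pull V z)) ∘ φ := by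
    intro V
    have hc : ContinuousAt φ x := continuousAt_extChartAt x
    filter_upwards [hpullV V, hc.eventually hkd, extChartAt_source_mem_nhds (I := 𝓡 n) x,
      hkφ.eventually_nhds] with y hy hd hs hkφ'
    rw [dirDeriv, mvfderiv_congr hkφ', hy]
    exact mvfderiv_comp_extChartAt hs hd _
  have hdiff : ∀ {V : VField n M}, MDifferentiableAt (𝓡 n) (𝓡 n).tangent
      (fun y => (⟨y, V y⟩ : TangentBundle (𝓡 n) M)) x → DifferentiableAt ℝ (pull V) (φ x) := by
    intro V hV
    have h1 : DifferentiableWithinAt ℝ (pull V) (φ.symm ⁻¹' Set.univ ∩ Set.range (𝓡 n)) (φ x) :=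
      (mdifferentiableWithinAt_univ.2 hV).differentiableWithinAt_mpullbackWithin_vectorField
    rwa [ModelWithCorners.range_eq_univ, Set.preimage_univ, Set.univ_inter,
      differentiableWithinAt_univ] at h1
  have hfk : DifferentiableAt ℝ (fderiv ℝ k) (φ x) :=
    (hkx.fderiv_right (m := 1) (by norm_cast)).differentiableAt (by simp)
  have second : ∀ {V W : VField n M}, MDifferentiableAt (𝓡 n) (𝓡 n).tangent
      (fun y => (⟨y, V y⟩ : TangentBundle (𝓡 n) M)) x →
      dirDeriv W (dirDeriv V h) x
        = fderiv ℝ (fun z => fderiv ℝ k z (pull V z)) (φ x) (pull W (φ x)) := by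
    intro V W hV
    rw [dirDeriv, mvfderiv_congr (key V), (hpullV W).self_of_nhds]
    exact mvfderiv_comp_extChartAt hxs (hfk.clm_apply (hdiff hV)) _
  rw [second hY, second hX, ← mlieBracketWithin_univ, mlieBracketWithin_apply,
    mvfderiv_congr hkφ]
  refine (mvfderiv_comp_extChartAt hxs (hkd.self_of_nhds) _).trans ?_
  rw [Set.preimage_univ, Set.univ_inter]
  have hr : lieBracketWithin ℝ (pull X) (pull Y) (Set.range (𝓡 n)) (φ x)
      = lieBracket ℝ (pull X) (pull Y) (φ x) := by
    rw [ModelWithCorners.range_eq_univ, lieBracketWithin_univ]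
  refine (congrArg (fderiv ℝ k (φ x)) hr).trans ?_
  exact fderiv_apply_lieBracket (n := ∞) hkx (by simp; norm_cast) (hdiff hY) (hdiff hX)

/-- The definitions quantify over fields smooth on all of `M`, so the chart-constant extension is
cut off by a bump function. Near `x` it is unchanged, which ties it to the extension used in
`secondForm`. -/
theorem exists_smoothField [T2Space M] (x : M) (v : TangentSpace (𝓡 n) x) :
    ∃ X : VField n M, IsSmoothField X ∧
      (∀ᶠ y in 𝓝 x, X y = FiberBundle.extend (EuclideanSpace ℝ (Fin n)) v y) ∧ X x = v := by
  obtain ⟨s, hs, hX⟩ := FiberBundle.exists_contMDiffOn_extend (𝓡 n) (EuclideanSpace ℝ (Fin n))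
    (V := (TangentSpace (𝓡 n) : M → Type _)) (k := ∞) v
  obtain ⟨t, hts, hto, hxt⟩ := mem_nhds_iff.1 hs
  obtain ⟨b, hb, -⟩ := (SmoothBumpFunction.nhds_basis_support (I := 𝓡 n)
    (hto.mem_nhds hxt)).mem_iff.1 (hto.mem_nhds hxt)
  refine ⟨_, ContMDiffOn.smul_section_of_tsupport b.contMDiff.contMDiffOn hto hb (hX.mono hts),
    ?_, by simp⟩
  filter_upwards [b.eventuallyEq_one] with y hy
  simp [hy]

/-- A smooth function defined near a point can be changed away from the point to be smooth
everywhere. -/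
theorem exists_contMDiff_eventuallyEq [T2Space M] {x : M} {U : Set M} (hU : U ∈ 𝓝 x) {h : M → F}
    (hh : ContMDiffOn (𝓡 n) 𝓘(ℝ, F) ∞ h U) :
    ∃ k : M → F, ContMDiff (𝓡 n) 𝓘(ℝ, F) ∞ k ∧ ∀ᶠ y in 𝓝 x, h y = k y := by
  obtain ⟨t, hts, hto, hxt⟩ := mem_nhds_iff.1 hU
  obtain ⟨b, hb, -⟩ := (SmoothBumpFunction.nhds_basis_support (I := 𝓡 n) (hto.mem_nhds hxt)).mem_iff.1
    (hto.mem_nhds hxt)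
  refine ⟨fun y => b y • h y, ?_, ?_⟩
  · refine contMDiff_of_tsupport fun y hy => ?_
    have hyt : y ∈ t := hb (closure_mono (Function.support_smul_subset_left _ _) hy)
    exact (b.contMDiff y).smul ((hh.mono hts).contMDiffAt (hto.mem_nhds hyt))
  · filter_upwards [b.eventuallyEq_one] with y hy
    simp [hy]

end Calculus

/-! ### Orthonormal families of a bilinear form. -/

section LinearAlgebra

variable {V W : Type*} [AddCommGroup V] [Module ℝ V] [AddCommGroup W] [Module ℝ W]

/-- The family `e` is orthonormal for the bilinear form `B`. -/
def IsOrthonormalFor (B : LinearMap.BilinForm ℝ V) {k : ℕ} (e : Fin k → V) : Prop :=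
  ∀ i j, B (e i) (e j) = if i = j then 1 else 0

theorem IsOrthonormalFor.apply_sum {B : LinearMap.BilinForm ℝ V} {k : ℕ} {e : Fin k → V}
    (he : IsOrthonormalFor B e) (c : Fin k → ℝ) (j : Fin k) : B (∑ i, c i • e i) (e j) = c j := by
  simp [he _ _]

theorem IsOrthonormalFor.linearIndependent {B : LinearMap.BilinForm ℝ V} {k : ℕ} {e : Fin k → V}
    (he : IsOrthonormalFor B e) : LinearIndependent ℝ e := by
  rw [Fintype.linearIndependent_iff]
  intro c hc j
  rw [← he.apply_sum c j, hc]
  simp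

theorem IsOrthonormalFor.span_eq {B : LinearMap.BilinForm ℝ V} {k : ℕ} {e : Fin k → V}
    (he : IsOrthonormalFor B e) {S : Submodule ℝ V} [FiniteDimensional ℝ S] (heS : ∀ i, e i ∈ S)
    (hS : Module.finrank ℝ S = k) : Submodule.span ℝ (Set.range e) = S := by
  apply Submodule.eq_of_le_of_finrank_eq
  · rw [Submodule.span_le]
    rintro _ ⟨i, rfl⟩
    exact heS i
  · rw [hS, finrank_span_eq_card he.linearIndependent, Fintype.card_fin]

theorem IsOrthonormalFor.expand {B : LinearMap.BilinForm ℝ V} {k : ℕ} {e : Fin k → V}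
    (he : IsOrthonormalFor B e) {S : Submodule ℝ V} [FiniteDimensional ℝ S] (heS : ∀ i, e i ∈ S)
    (hS : Module.finrank ℝ S = k) {v : V} (hv : v ∈ S) : v = ∑ i, B v (e i) • e i := by
  rw [← he.span_eq heS hS, Submodule.mem_span_range_iff_exists_fun] at hv
  obtain ⟨c, rfl⟩ := hv
  exact Finset.sum_congr rfl fun i _ => by rw [he.apply_sum]

theorem IsOrthonormalFor.expand_top {B : LinearMap.BilinForm ℝ V} {k : ℕ} {e : Fin k → V}
    (he : IsOrthonormalFor B e) [FiniteDimensional ℝ V] (hk : Module.finrank ℝ V = k) (v : V) :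
    v = ∑ i, B v (e i) • e i :=
  he.expand (S := ⊤) (by simp) (by simpa using hk) (by simp)

/-- Expanding one frame in the other and contracting back shows that a trace is frame independent.
It frees ℋ and ‖α‖² from the arbitrarily chosen frame in their definitions. -/
theorem sum_diagonal_eq {B : LinearMap.BilinForm ℝ V} (hB : ∀ v w, B v w = B w v) {k : ℕ}
    {e e' : Fin k → V} [FiniteDimensional ℝ V] (hk : Module.finrank ℝ V = k)
    (he : IsOrthonormalFor B e) (he' : IsOrthonormalFor B e') (C : V →ₗ[ℝ] V →ₗ[ℝ] W) :
    ∑ i, C (e i) (e i) = ∑ i, C (e' i) (e' i) := by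
  calc ∑ i, C (e i) (e i) = ∑ i, ∑ j, B (e i) (e' j) • C (e' j) (e i) := by
        refine Finset.sum_congr rfl fun i _ => ?_
        refine (congrArg (fun v => C v (e i)) (he'.expand_top hk (e i))).trans ?_
        simp
    _ = ∑ j, ∑ i, B (e' j) (e i) • C (e' j) (e i) := by
        rw [Finset.sum_comm]
        simp_rw [hB]
    _ = ∑ j, C (e' j) (e' j) := by
        refine Finset.sum_congr rfl fun j _ => ?_
        refine Eq.trans ?_ (congrArg (C (e' j)) (he.expand_top hk (e' j))).symm
        simp

end LinearAlgebra

/-! ### The induced metric, tangential parts and orthonormal frames. -/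

section Immersion

variable {n m : ℕ} {M : Type*} [TopologicalSpace M]
  [ChartedSpace (EuclideanSpace ℝ (Fin n)) M]
  {f : M → EuclideanSpace ℝ (Fin m)}

instance (x : M) : FiniteDimensional ℝ (TangentSpace (𝓡 n) x) :=
  inferInstanceAs (FiniteDimensional ℝ (EuclideanSpace ℝ (Fin n)))

theorem finrank_tangentSpace (x : M) : Module.finrank ℝ (TangentSpace (𝓡 n) x) = n :=
  finrank_euclideanSpace_fin (𝕜 := ℝ) (n := n)

theorem inducedMetric_apply (x : M) (v w : TangentSpace (𝓡 n) x) :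
    inducedMetric f x v w = inner ℝ (mvfderiv (𝓡 n) f x v) (mvfderiv (𝓡 n) f x w) := rfl

theorem inducedMetric_symm (x : M) (v w : TangentSpace (𝓡 n) x) :
    inducedMetric f x v w = inducedMetric f x w v := by
  rw [inducedMetric_apply, inducedMetric_apply, real_inner_comm]

theorem IsSmoothImmersion.inducedMetric_pos (hf : IsSmoothImmersion (n := n) f) {x : M}
    {v : TangentSpace (𝓡 n) x} (hv : v ≠ 0) : 0 < inducedMetric f x v v := by
  rw [inducedMetric_apply, real_inner_self_eq_norm_sq]
  have : mvfderiv (𝓡 n) f x v ≠ 0 := fun h => hv (hf.2 x (by rw [h, map_zero]))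
  positivity

theorem IsSmoothImmersion.eq_zero (hf : IsSmoothImmersion (n := n) f) {x : M}
    {v : TangentSpace (𝓡 n) x} (hv : ∀ w, inducedMetric f x v w = 0) : v = 0 := by
  by_contra h
  exact (hf.inducedMetric_pos h).ne' (hv v)

theorem IsSmoothImmersion.eq_of_forall (hf : IsSmoothImmersion (n := n) f) {x : M}
    {v v' : TangentSpace (𝓡 n) x} (hv : ∀ w, inducedMetric f x v w = inducedMetric f x v' w) :
    v = v' := by
  rw [← sub_eq_zero]
  exact hf.eq_zero fun w => by rw [map_sub, LinearMap.sub_apply, hv, sub_self]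

theorem mem_normalSpace {x : M} {w : EuclideanSpace ℝ (Fin m)} :
    w ∈ normalSpace (n := n) f x ↔ ∀ v, inner ℝ (mvfderiv (𝓡 n) f x v) w = 0 := by
  simp [normalSpace, Submodule.mem_orthogonal]

theorem starProjection_mvfderiv (x : M) (v : TangentSpace (𝓡 n) x) :
    (normalSpace (n := n) f x).starProjection (mvfderiv (𝓡 n) f x v) = 0 := by
  rw [Submodule.starProjection_apply_eq_zero_iff, Submodule.mem_orthogonal']
  exact fun u hu => (mem_normalSpace (n := n)).1 hu v

theorem exists_tangent (x : M) (w : EuclideanSpace ℝ (Fin m)) :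
    ∃ v : TangentSpace (𝓡 n) x,
      mvfderiv (𝓡 n) f x v = w - (normalSpace (n := n) f x).starProjection w := by
  have h := Submodule.sub_starProjection_mem_orthogonal (K := normalSpace (n := n) f x) w
  rw [normalSpace, Submodule.orthogonal_orthogonal] at h
  exact h

/-- The tangent vector `v` with `f_* v` the tangential component of `w`. -/
noncomputable def tangentPart (f : M → EuclideanSpace ℝ (Fin m)) (x : M)
    (w : EuclideanSpace ℝ (Fin m)) : TangentSpace (𝓡 n) x :=
  (exists_tangent (f := f) x w).choose

theorem mvfderiv_tangentPart (x : M) (w : EuclideanSpace ℝ (Fin m)) :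
    mvfderiv (𝓡 n) f x (tangentPart f x w)
      = w - (normalSpace (n := n) f x).starProjection w :=
  (exists_tangent (f := f) x w).choose_spec

theorem inducedMetric_tangentPart (x : M) (w : EuclideanSpace ℝ (Fin m))
    (v : TangentSpace (𝓡 n) x) :
    inducedMetric f x (tangentPart f x w) v = inner ℝ w (mvfderiv (𝓡 n) f x v) := by
  rw [inducedMetric_apply, mvfderiv_tangentPart, inner_sub_left, sub_eq_self, real_inner_comm]
  exact (mem_normalSpace (n := n)).1 (Submodule.starProjection_apply_mem _ _) v

/-- An injective map into a dual space of equal dimension is onto. This supplies the witnesses that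
make the `Classical.epsilon` choices for gradients and for the conformally changed connection
meaningful. -/
theorem IsSmoothImmersion.exists_dual (hf : IsSmoothImmersion (n := n) f) (x : M)
    (θ : TangentSpace (𝓡 n) x →ₗ[ℝ] ℝ) : ∃ v, ∀ w, inducedMetric f x v w = θ w := by
  have hinj : Function.Injective (inducedMetric (n := n) f x) := by
    rw [← LinearMap.ker_eq_bot, LinearMap.ker_eq_bot']
    intro v hv
    exact hf.eq_zero fun w => by rw [hv, LinearMap.zero_apply]
  obtain ⟨v, hv⟩ := (LinearMap.injective_iff_surjective_of_finrank_eq_finrank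
    (Subspace.dual_finrank_eq (K := ℝ) (V := TangentSpace (𝓡 n) x)).symm).1 hinj θ
  exact ⟨v, fun w => by rw [hv]⟩

variable [IsManifold (𝓡 n) ∞ M]

omit [IsManifold (𝓡 n) ∞ M] in
theorem contMDiff_inner {h k : M → EuclideanSpace ℝ (Fin m)} (hh : ContMDiff (𝓡 n) (𝓡 m) ∞ h)
    (hk : ContMDiff (𝓡 n) (𝓡 m) ∞ k) :
    ContMDiff (𝓡 n) 𝓘(ℝ) ∞ (fun x => inner ℝ (h x) (k x)) :=
  contDiff_inner.contMDiff.comp (hh.prodMk_space hk)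

theorem IsSmoothImmersion.contMDiff_inducedMetric (hf : IsSmoothImmersion (n := n) f)
    {X Y : VField n M} (hX : IsSmoothField X) (hY : IsSmoothField Y) :
    ContMDiff (𝓡 n) 𝓘(ℝ) ∞ (fun x => inducedMetric f x (X x) (Y x)) :=
  contMDiff_inner (dirDeriv_contMDiff hX hf.1) (dirDeriv_contMDiff hY hf.1)

variable [T2Space M]

/-- Gram–Schmidt, one vector at a time. The rank of `E` need not be constant: only vectors at `x`
have to extend to local sections. -/
theorem exists_orthonormal_sections (hf : IsSmoothImmersion (n := n) f)
    (E : TangentDistribution n M) (x : M)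
    (hE : ∀ v ∈ E x, ∃ W, IsSmoothField W ∧ (∀ᶠ y in 𝓝 x, W y ∈ E y) ∧ W x = v) :
    ∀ k ≤ Module.finrank ℝ (E x), ∃ e : Fin k → VField n M, (∀ i, IsSmoothField (e i)) ∧
      ∀ᶠ y in 𝓝 x, (∀ i, e i y ∈ E y) ∧
        IsOrthonormalFor (inducedMetric f y) (fun i => e i y) := by
  intro k
  induction k with
  | zero => exact fun _ => ⟨Fin.elim0, fun i => i.elim0, by simp [IsOrthonormalFor]⟩
  | succ k ih =>
    intro hk
    obtain ⟨e, hes, he⟩ := ih (by omega)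
    have hne : ∃ v ∈ E x, v ∉ Submodule.span ℝ (Set.range fun i => e i x) := by
      by_contra! hcon
      have h1 := Submodule.finrank_mono hcon
      have h2 := finrank_range_le_card (R := ℝ) (fun i => e i x)
      rw [Fintype.card_fin] at h2
      exact absurd (hk.trans (h1.trans h2)) (by omega)
    obtain ⟨v, hvE, hv⟩ := hne
    obtain ⟨W, hWs, hWE, hWx⟩ := hE v hvE
    set W' : VField n M := fun y => W y - ∑ i, inducedMetric f y (W y) (e i y) • e i y with hW'
    have hW's : IsSmoothField W' := hWs.sub (IsSmoothField.sum fun i _ =>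
      (hes i).smul (hf.contMDiff_inducedMetric hWs (hes i)))
    have hW'x : W' x ≠ 0 := by
      intro h
      rw [hW', sub_eq_zero, hWx] at h
      apply hv
      rw [h]
      exact Submodule.sum_mem _ fun i _ => Submodule.smul_mem _ _
        (Submodule.subset_span ⟨i, rfl⟩)
    set q : M → ℝ := fun y => inducedMetric f y (W' y) (W' y) with hq
    have hqs : ContMDiff (𝓡 n) 𝓘(ℝ) ∞ q := hf.contMDiff_inducedMetric hW's hW's
    have hU : {y | 0 < q y} ∈ 𝓝 x :=
      (isOpen_lt continuous_const hqs.continuous).mem_nhds (hf.inducedMetric_pos hW'x)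
    -- The normalising factor is smooth only where `q > 0`, so it is replaced by a global smooth
    -- function agreeing with it near `x`.
    obtain ⟨c, hcs, hc⟩ := exists_contMDiff_eventuallyEq (n := n) hU (h := fun y => (√(q y))⁻¹)
      (fun y hy => ((Real.contDiffAt_sqrt (ne_of_gt hy)).inv
        (Real.sqrt_ne_zero'.2 hy)).contMDiffAt.comp_contMDiffWithinAt y (hqs y).contMDiffWithinAt)
    refine ⟨Fin.snoc e (fun y => c y • W' y), ?_, ?_⟩
    · intro i
      refine Fin.lastCases ?_ (fun i => ?_) i
      · simpa using hW's.smul hcs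
      · simpa using hes i
    · filter_upwards [he, hWE, hU, hc] with y hy hWy hqy hcy
      have hW'E : W' y ∈ E y := Submodule.sub_mem _ hWy
        (Submodule.sum_mem _ fun i _ => Submodule.smul_mem _ _ (hy.1 i))
      have horth : ∀ j, inducedMetric f y (W' y) (e j y) = 0 := by
        intro j
        rw [hW', map_sub, LinearMap.sub_apply, hy.2.apply_sum, sub_self]
      have hnorm : c y * (c y * q y) = 1 := by
        rw [← hcy]
        field_simp
        rw [Real.sq_sqrt (le_of_lt hqy)]
      refine ⟨fun i => ?_, fun i j => ?_⟩
      · refine Fin.lastCases ?_ (fun i => ?_) i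
        · simpa using Submodule.smul_mem _ _ hW'E
        · simpa using hy.1 i
      · refine Fin.lastCases ?_ (fun i => ?_) i <;> refine Fin.lastCases ?_ (fun j => ?_) j
        · simpa using hnorm
        · simp [horth j, (Fin.castSucc_lt_last j).ne']
        · have := horth i
          rw [inducedMetric_symm] at this
          simp [this, (Fin.castSucc_lt_last i).ne]
        · simpa using hy.2 i j

theorem exists_orthonormal_frame (hf : IsSmoothImmersion (n := n) f) (x : M) :
    ∃ e : Fin n → VField n M, (∀ i, IsSmoothField (e i)) ∧
      ∀ᶠ y in 𝓝 x, IsOrthonormalFor (inducedMetric f y) (fun i => e i y) := by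
  obtain ⟨e, hes, he⟩ := exists_orthonormal_sections hf (fun _ => ⊤) x
    (fun v _ => by
      obtain ⟨W, hW, -, h⟩ := exists_smoothField x v
      exact ⟨W, hW, by simp, h⟩) n (by simp [finrank_tangentSpace])
  exact ⟨e, hes, he.mono fun y hy => hy.2⟩

/-- In a local orthonormal frame the coefficients of `V` are its inner products with the frame.
Fields defined pointwise by duality become smooth this way. -/
theorem isSmoothField_of_inner (hf : IsSmoothImmersion (n := n) f) {V : VField n M}
    (hV : ∀ Y, IsSmoothField Y →
      ContMDiff (𝓡 n) 𝓘(ℝ) ∞ (fun x => inducedMetric f x (V x) (Y x))) : IsSmoothField V := by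
  refine isSmoothField_of_local fun x => ?_
  obtain ⟨e, hes, he⟩ := exists_orthonormal_frame hf x
  refine ⟨_, IsSmoothField.sum (s := Finset.univ) fun i _ => (hes i).smul (hV _ (hes i)), ?_⟩
  filter_upwards [he] with y hy
  exact hy.expand_top (finrank_tangentSpace y) (V y)

theorem isSmoothField_tangentPart (hf : IsSmoothImmersion (n := n) f)
    {h : M → EuclideanSpace ℝ (Fin m)} (hh : ContMDiff (𝓡 n) (𝓡 m) ∞ h) :
    IsSmoothField (fun x => tangentPart (n := n) f x (h x)) := by
  refine isSmoothField_of_inner hf fun Y hY => ?_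
  simp_rw [inducedMetric_tangentPart]
  exact contMDiff_inner hh (dirDeriv_contMDiff hY hf.1)

theorem contMDiff_normal (hf : IsSmoothImmersion (n := n) f)
    {h : M → EuclideanSpace ℝ (Fin m)} (hh : ContMDiff (𝓡 n) (𝓡 m) ∞ h) :
    ContMDiff (𝓡 n) (𝓡 m) ∞ (fun x => (normalSpace (n := n) f x).starProjection (h x)) := by
  have := hh.sub (dirDeriv_contMDiff (isSmoothField_tangentPart hf hh) hf.1)
  refine this.congr fun x => ?_
  change _ = h x - mvfderiv (𝓡 n) f x (tangentPart f x (h x))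
  rw [mvfderiv_tangentPart, sub_sub_cancel]

theorem orthonormalFrame_spec (hf : IsSmoothImmersion (n := n) f) (x : M) :
    IsOrthonormalFor (inducedMetric f x) (orthonormalFrame (n := n) (inducedMetric f) x) := by
  obtain ⟨e, -, he⟩ := exists_orthonormal_frame hf x
  exact Classical.epsilon_spec (p := fun e : Fin n → TangentSpace (𝓡 n) x =>
    ∀ i j, inducedMetric f x (e i) (e j) = if i = j then 1 else 0) ⟨_, he.self_of_nhds⟩

/-! ### The second fundamental form -/

/-- This is tensoriality of α in its second argument: D_X f_*W = f_*[X, W] + D_W f_*X, where the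
first term is tangent and the second vanishes with `W`. -/
theorem normal_mvfderiv_of_eq_zero (hf : IsSmoothImmersion (n := n) f) {W : VField n M}
    (hW : IsSmoothField W) {x : M} (hWx : W x = 0) (v : TangentSpace (𝓡 n) x) :
    (normalSpace (n := n) f x).starProjection (mvfderiv (𝓡 n) (dirDeriv W f) x v) = 0 := by
  obtain ⟨X, hX, -, rfl⟩ := exists_smoothField x v
  have h := bracket_dirDeriv (hX.mdifferentiableAt x) (hW.mdifferentiableAt x) hf.1
  have h0 : dirDeriv W (dirDeriv X f) x = 0 := by rw [dirDeriv, hWx, map_zero]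
  rw [h0, sub_zero] at h
  change (normalSpace (n := n) f x).starProjection (dirDeriv X (dirDeriv W f) x) = 0
  rw [← h, starProjection_mvfderiv]

omit [T2Space M] in
theorem mvfderiv_dirDeriv_sub (hf : IsSmoothImmersion (n := n) f) {Y W : VField n M}
    (hY : IsSmoothField Y) (hW : IsSmoothField W) (x : M) :
    mvfderiv (𝓡 n) (dirDeriv (fun y => Y y - W y) f) x
      = mvfderiv (𝓡 n) (dirDeriv Y f) x - mvfderiv (𝓡 n) (dirDeriv W f) x := by
  have : dirDeriv (fun y => Y y - W y) f = dirDeriv Y f - dirDeriv W f := by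
    funext y
    simp [dirDeriv]
  rw [this, mvfderiv_sub ((dirDeriv_contMDiff hY hf.1 x).mdifferentiableAt (by simp))
    ((dirDeriv_contMDiff hW hf.1 x).mdifferentiableAt (by simp))]

theorem secondForm_eq (hf : IsSmoothImmersion (n := n) f) {Y : VField n M}
    (hY : IsSmoothField Y) (x : M) (v : TangentSpace (𝓡 n) x) :
    secondForm f x v (Y x)
      = (normalSpace (n := n) f x).starProjection (mvfderiv (𝓡 n) (dirDeriv Y f) x v) := by
  obtain ⟨W, hW, hWe, hWx⟩ := exists_smoothField x (Y x)
  have h1 : mvfderiv (𝓡 n) (fun y => mvfderiv (𝓡 n) f y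
      (FiberBundle.extend (EuclideanSpace ℝ (Fin n)) (Y x) y)) x
      = mvfderiv (𝓡 n) (dirDeriv W f) x :=
    mvfderiv_congr (hWe.mono fun y hy => by simp only [dirDeriv, hy])
  rw [secondForm, h1, eq_comm, ← sub_eq_zero, ← map_sub, ← sub_apply,
    ← mvfderiv_dirDeriv_sub hf hY hW]
  exact normal_mvfderiv_of_eq_zero hf (hY.sub hW) (by rw [hWx, sub_self]) v

theorem secondForm_symm (hf : IsSmoothImmersion (n := n) f) (x : M)
    (v w : TangentSpace (𝓡 n) x) : secondForm f x v w = secondForm f x w v := by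
  obtain ⟨X, hX, -, rfl⟩ := exists_smoothField x v
  obtain ⟨Y, hY, -, rfl⟩ := exists_smoothField x w
  have h := bracket_dirDeriv (hX.mdifferentiableAt x) (hY.mdifferentiableAt x) hf.1
  have h2 := starProjection_mvfderiv (f := f) x (mlieBracket (𝓡 n) X Y x)
  rw [h, map_sub, sub_eq_zero] at h2
  rw [secondForm_eq hf hY, secondForm_eq hf hX]
  exact h2

omit [T2Space M] in
theorem secondForm_mem (x : M) (v w : TangentSpace (𝓡 n) x) :
    secondForm f x v w ∈ normalSpace (n := n) f x := Submodule.starProjection_apply_mem _ _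

/-- The second fundamental form as a bilinear map. -/
noncomputable def secondFormBilin (hf : IsSmoothImmersion (n := n) f) (x : M) :
    TangentSpace (𝓡 n) x →ₗ[ℝ] TangentSpace (𝓡 n) x →ₗ[ℝ] EuclideanSpace ℝ (Fin m) :=
  LinearMap.mk₂ ℝ (secondForm f x) (fun a b w => by simp [secondForm])
    (fun c a w => by simp [secondForm])
    (fun v a b => by
      rw [secondForm_symm hf x v, secondForm_symm hf x v, secondForm_symm hf x v]
      simp [secondForm])
    (fun c v a => by
      rw [secondForm_symm hf x v, secondForm_symm hf x v]
      simp [secondForm])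

@[simp] theorem secondFormBilin_apply (hf : IsSmoothImmersion (n := n) f) (x : M)
    (v w : TangentSpace (𝓡 n) x) : secondFormBilin hf x v w = secondForm f x v w := rfl

theorem contMDiff_secondForm (hf : IsSmoothImmersion (n := n) f) {X Y : VField n M}
    (hX : IsSmoothField X) (hY : IsSmoothField Y) :
    ContMDiff (𝓡 n) (𝓡 m) ∞ (fun x => secondForm f x (X x) (Y x)) :=
  (contMDiff_normal hf (dirDeriv_contMDiff hX (dirDeriv_contMDiff hY hf.1))).congr
    fun x => secondForm_eq hf hY x (X x)

end Immersion

/-! ### Product and chain rules. -/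

section Derivatives

variable {n m : ℕ} {M : Type*} [TopologicalSpace M]
  [ChartedSpace (EuclideanSpace ℝ (Fin n)) M]

theorem mvfderiv_inner {h k : M → EuclideanSpace ℝ (Fin m)} {x : M}
    (hh : MDifferentiableAt (𝓡 n) (𝓡 m) h x) (hk : MDifferentiableAt (𝓡 n) (𝓡 m) k x)
    (v : TangentSpace (𝓡 n) x) :
    mvfderiv (𝓡 n) (fun y => (inner ℝ (h y) (k y) : ℝ)) x v
      = inner ℝ (h x) (mvfderiv (𝓡 n) k x v) + inner ℝ (mvfderiv (𝓡 n) h x v) (k x) := by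
  have hd : MDifferentiableAt (𝓡 n) 𝓘(ℝ) (fun y => (inner ℝ (h y) (k y) : ℝ)) x :=
    (contDiff_inner (n := 1)).contMDiff.mdifferentiableAt (by simp) |>.comp x (hh.prodMk_space hk)
  rw [hd.mvfderiv, hh.mvfderiv, hk.mvfderiv]
  have h1 := hh.differentiableWithinAt_writtenInExtChartAt
  have h2 := hk.differentiableWithinAt_writtenInExtChartAt
  have h3 := (h1.hasFDerivWithinAt.inner ℝ h2.hasFDerivWithinAt).fderivWithin
    ((𝓡 n).uniqueDiffOn _ (Set.mem_range_self (chartAt (EuclideanSpace ℝ (Fin n)) x x)))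
  have e : ∀ l : M → EuclideanSpace ℝ (Fin m),
      writtenInExtChartAt (𝓡 n) (𝓡 m) x l (extChartAt (𝓡 n) x x) = l x := fun l => by
    simp only [writtenInExtChartAt, Function.comp_apply, extChartAt_to_inv]
    rfl
  rw [e, e] at h3
  exact congrArg (fun L => L v) h3

theorem mvfderiv_comp_real {c : ℝ → ℝ} {r : M → ℝ} {x : M} {c' : ℝ} (hc : HasDerivAt c c' (r x))
    (hr : MDifferentiableAt (𝓡 n) 𝓘(ℝ) r x) (v : TangentSpace (𝓡 n) x) :
    mvfderiv (𝓡 n) (fun y => c (r y)) x v = c' * mvfderiv (𝓡 n) r x v := by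
  have h1 := mvfderiv_comp_apply x hc.differentiableAt.mdifferentiableAt hr v
  refine h1.trans ?_
  have h2 : mvfderiv 𝓘(ℝ) c (r x) = fderiv ℝ c (r x) := by
    rw [mvfderiv, mfderiv_eq_fderiv]; rfl
  rw [h2, hc.hasFDerivAt.fderiv]
  exact mul_comm (mvfderiv (𝓡 n) r x v) c'

end Derivatives

/-! ### Levi-Civita connection, conformal change, normal curvature and Hessians. -/

section Curvature

variable {n m : ℕ} {M : Type*} [TopologicalSpace M] [T2Space M]
  [ChartedSpace (EuclideanSpace ℝ (Fin n)) M] [IsManifold (𝓡 n) ∞ M]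
  {f : M → EuclideanSpace ℝ (Fin m)}

omit [T2Space M] [IsManifold (𝓡 n) ∞ M] in
theorem ContMDiff.mdiffAt {F : Type*} [NormedAddCommGroup F] [NormedSpace ℝ F] {h : M → F}
    (hh : ContMDiff (𝓡 n) 𝓘(ℝ, F) ∞ h) (x : M) : MDifferentiableAt (𝓡 n) 𝓘(ℝ, F) h x :=
  (hh x).mdifferentiableAt (by simp)

omit [T2Space M] in
theorem IsSmoothField.push (hf : IsSmoothImmersion (n := n) f) {X : VField n M}
    (hX : IsSmoothField X) : ContMDiff (𝓡 n) (𝓡 m) ∞ (dirDeriv X f) := dirDeriv_contMDiff hX hf.1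

omit [T2Space M] [IsManifold (𝓡 n) ∞ M] in
theorem dirDeriv_inner {h k : M → EuclideanSpace ℝ (Fin m)}
    (hh : ContMDiff (𝓡 n) (𝓡 m) ∞ h) (hk : ContMDiff (𝓡 n) (𝓡 m) ∞ k) (X : VField n M) (x : M) :
    dirDeriv X (fun y => (inner ℝ (h y) (k y) : ℝ)) x
      = inner ℝ (h x) (dirDeriv X k x) + inner ℝ (dirDeriv X h x) (k x) :=
  mvfderiv_inner (hh.mdiffAt x) (hk.mdiffAt x) (X x)

-- The product rule splits the metric derivatives, `bracket_dirDeriv` splits the brackets, and all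
-- but one pair of terms cancels. Hence ∇_X Y is the tangential part of D_X f_*Y.
omit [T2Space M] in
theorem koszul_inducedMetric (hf : IsSmoothImmersion (n := n) f) {X Y Z : VField n M}
    (hX : IsSmoothField X) (hY : IsSmoothField Y) (hZ : IsSmoothField Z) (x : M) :
    koszul (inducedMetric f) X Y Z x
      = 2 * inner ℝ (dirDeriv X (dirDeriv Y f) x) (dirDeriv Z f x) := by
  have hXY := bracket_dirDeriv (hX.mdifferentiableAt x) (hY.mdifferentiableAt x) hf.1
  have hXZ := bracket_dirDeriv (hX.mdifferentiableAt x) (hZ.mdifferentiableAt x) hf.1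
  have hYZ := bracket_dirDeriv (hY.mdifferentiableAt x) (hZ.mdifferentiableAt x) hf.1
  have e : ∀ A B C : VField n M, IsSmoothField A → IsSmoothField B →
      dirDeriv C (fun y => inducedMetric f y (A y) (B y)) x
        = inner ℝ (dirDeriv A f x) (dirDeriv C (dirDeriv B f) x)
          + inner ℝ (dirDeriv C (dirDeriv A f) x) (dirDeriv B f x) := fun A B C hA hB =>
    dirDeriv_inner (hA.push hf) (hB.push hf) C x
  rw [koszul, e Y Z X hY hZ, e X Z Y hX hZ, e X Y Z hX hY, inducedMetric_apply,
    inducedMetric_apply, inducedMetric_apply, hXY, hXZ, hYZ]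
  change _ + _ - _ + inner ℝ _ (dirDeriv Z f x) - inner ℝ _ (dirDeriv Y f x)
    - inner ℝ _ (dirDeriv X f x) = _
  simp only [inner_sub_left]
  rw [real_inner_comm (dirDeriv X (dirDeriv Z f) x), real_inner_comm (dirDeriv Y (dirDeriv Z f) x),
    real_inner_comm (dirDeriv X f x) (dirDeriv Z (dirDeriv Y f) x)]
  ring

omit [T2Space M] in
theorem leviCivita_spec {g : MetricField n M} {X Y : VField n M} {x : M}
    {v : TangentSpace (𝓡 n) x}
    (h : ∀ Z : VField n M, IsSmoothField Z → 2 * g x v (Z x) = koszul g X Y Z x)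
    {Z : VField n M} (hZ : IsSmoothField Z) :
    2 * g x (leviCivita g X Y x) (Z x) = koszul g X Y Z x :=
  Classical.epsilon_spec (p := fun v : TangentSpace (𝓡 n) x =>
    ∀ Z : VField n M, IsSmoothField Z → 2 * g x v (Z x) = koszul g X Y Z x) ⟨v, h⟩ Z hZ

theorem inducedMetric_leviCivita (hf : IsSmoothImmersion (n := n) f) {X Y : VField n M}
    (hX : IsSmoothField X) (hY : IsSmoothField Y) (x : M) (w : TangentSpace (𝓡 n) x) :
    inducedMetric f x (leviCivita (inducedMetric f) X Y x) w
      = inner ℝ (dirDeriv X (dirDeriv Y f) x) (mvfderiv (𝓡 n) f x w) := by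
  obtain ⟨Z, hZ, -, rfl⟩ := exists_smoothField x w
  have h := leviCivita_spec (g := inducedMetric f) (X := X) (Y := Y)
    (v := tangentPart f x (dirDeriv X (dirDeriv Y f) x)) (fun Z hZ => by
      rw [inducedMetric_tangentPart, koszul_inducedMetric hf hX hY hZ]; rfl) hZ
  rw [koszul_inducedMetric hf hX hY hZ] at h
  exact mul_left_cancel₀ two_ne_zero h

omit [T2Space M] in
theorem koszul_conformal (hf : IsSmoothImmersion (n := n) f) {r : M → ℝ}
    (hr : ContMDiff (𝓡 n) 𝓘(ℝ) ∞ r) {X Y Z : VField n M}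
    (hX : IsSmoothField X) (hY : IsSmoothField Y) (hZ : IsSmoothField Z) (x : M) :
    koszul (fun y => r y • inducedMetric f y) X Y Z x
      = r x * koszul (inducedMetric f) X Y Z x
        + mvfderiv (𝓡 n) r x (X x) * inducedMetric f x (Y x) (Z x)
        + mvfderiv (𝓡 n) r x (Y x) * inducedMetric f x (X x) (Z x)
        - mvfderiv (𝓡 n) r x (Z x) * inducedMetric f x (X x) (Y x) := by
  have e : ∀ A B C : VField n M, IsSmoothField A → IsSmoothField B →
      dirDeriv C (fun y => (r y • inducedMetric f y) (A y) (B y)) x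
        = r x * dirDeriv C (fun y => inducedMetric f y (A y) (B y)) x
          + inducedMetric f x (A x) (B x) * mvfderiv (𝓡 n) r x (C x) := by
    intro A B C hA hB
    have := mvfderiv_fun_mul (hr.mdiffAt x) ((hf.contMDiff_inducedMetric hA hB).mdiffAt x)
    have := congrArg (fun L => L (C x)) this
    simpa [dirDeriv] using this
  rw [koszul, e Y Z X hY hZ, e X Z Y hX hZ, e X Y Z hX hY, koszul]
  simp only [LinearMap.smul_apply, smul_eq_mul]
  ring

omit [T2Space M] in
theorem leviCivita_conformal (hf : IsSmoothImmersion (n := n) f) {r : M → ℝ}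
    (hr : ContMDiff (𝓡 n) 𝓘(ℝ) ∞ r) (hr0 : ∀ x, r x ≠ 0) {X Y Z : VField n M}
    (hX : IsSmoothField X) (hY : IsSmoothField Y) (hZ : IsSmoothField Z) (x : M) :
    2 * (r x * inducedMetric f x (leviCivita (fun y => r y • inducedMetric f y) X Y x) (Z x))
      = 2 * (r x * inner ℝ (dirDeriv X (dirDeriv Y f) x) (dirDeriv Z f x))
        + mvfderiv (𝓡 n) r x (X x) * inducedMetric f x (Y x) (Z x)
        + mvfderiv (𝓡 n) r x (Y x) * inducedMetric f x (X x) (Z x)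
        - mvfderiv (𝓡 n) r x (Z x) * inducedMetric f x (X x) (Y x) := by
  -- The functional is the conformal Koszul expression divided by 2r; its dual vector shows that the
  -- changed connection exists.
  obtain ⟨v, hv⟩ := hf.exists_dual x (((2 * r x)⁻¹) •
    ((2 * r x) • ((inducedMetric f x) (tangentPart f x (dirDeriv X (dirDeriv Y f) x)))
      + mvfderiv (𝓡 n) r x (X x) • inducedMetric f x (Y x)
      + mvfderiv (𝓡 n) r x (Y x) • inducedMetric f x (X x)
      - inducedMetric f x (X x) (Y x) • (mvfderiv (𝓡 n) r x).toLinearMap))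
  have h := leviCivita_spec (g := fun y => r y • inducedMetric f y) (X := X) (Y := Y) (x := x)
    (v := v) (fun Z hZ => by
      rw [koszul_conformal hf hr hX hY hZ, LinearMap.smul_apply, LinearMap.smul_apply, hv,
        koszul_inducedMetric hf hX hY hZ]
      simp only [LinearMap.smul_apply, LinearMap.sub_apply, LinearMap.add_apply, smul_eq_mul,
        inducedMetric_tangentPart]
      have := hr0 x
      field_simp
      simp only [dirDeriv, ContinuousLinearMap.coe_coe]) hZ
  rw [koszul_conformal hf hr hX hY hZ, koszul_inducedMetric hf hX hY hZ] at h
  simp only [LinearMap.smul_apply, smul_eq_mul] at h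
  rw [h]
  ring

/-- The curvature of the normal part of the trivial connection on the ambient space. -/
theorem normalConnection_curvature (hf : IsSmoothImmersion (n := n) f) {X Y : VField n M}
    (hX : IsSmoothField X) (hY : IsSmoothField Y) {G : M → EuclideanSpace ℝ (Fin m)}
    (hG : ContMDiff (𝓡 n) (𝓡 m) ∞ G) (x : M) :
    normalConnection f X (normalConnection f Y G) x
        - normalConnection f Y (normalConnection f X G) x
        - normalConnection f (mlieBracket (𝓡 n) X Y) G x
      = secondForm f x (Y x) (tangentPart f x (dirDeriv X G x))
        - secondForm f x (X x) (tangentPart f x (dirDeriv Y G x)) := by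
  have key : ∀ {A B : VField n M}, IsSmoothField A → IsSmoothField B →
      normalConnection f A (normalConnection f B G) x
        = (normalSpace (n := n) f x).starProjection (dirDeriv A (dirDeriv B G) x)
          - secondForm f x (A x) (tangentPart f x (dirDeriv B G x)) := by
    intro A B hA hB
    have hBG := dirDeriv_contMDiff hB hG
    have hV := isSmoothField_tangentPart hf hBG
    -- Removing the normal projection costs a tangent field f_*V, whose derivative along `A` has
    -- normal part α(A, V).
    have h1 : normalConnection f B G = dirDeriv B G
        - dirDeriv (fun y => tangentPart (n := n) f y (dirDeriv B G y)) f := by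
      funext y
      rw [Pi.sub_apply]
      change _ = dirDeriv B G y - mvfderiv (𝓡 n) f y (tangentPart (n := n) f y (dirDeriv B G y))
      rw [mvfderiv_tangentPart, sub_sub_cancel]
      rfl
    have h2 : dirDeriv A (normalConnection f B G) x = dirDeriv A (dirDeriv B G) x
        - dirDeriv A (dirDeriv (fun y => tangentPart (n := n) f y (dirDeriv B G y)) f) x := by
      rw [h1, dirDeriv, mvfderiv_sub (hBG.mdiffAt x) ((hV.push hf).mdiffAt x)]
      rfl
    rw [normalConnection, h2, map_sub, secondForm_eq hf hV]
    rfl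
  have hb := bracket_dirDeriv (hX.mdifferentiableAt x) (hY.mdifferentiableAt x) hG
  have hb' : normalConnection f (mlieBracket (𝓡 n) X Y) G x
      = (normalSpace (n := n) f x).starProjection
        (dirDeriv X (dirDeriv Y G) x - dirDeriv Y (dirDeriv X G) x) := by
    rw [← hb]; rfl
  rw [key hX hY, key hY hX, hb', map_sub]
  abel

omit [T2Space M] [IsManifold (𝓡 n) ∞ M] in
theorem tangentPart_sub (hf : IsSmoothImmersion (n := n) f) (x : M)
    (a b : EuclideanSpace ℝ (Fin m)) :
    tangentPart (n := n) f x (a - b) = tangentPart f x a - tangentPart f x b := by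
  apply hf.2 x
  rw [map_sub, mvfderiv_tangentPart, mvfderiv_tangentPart, mvfderiv_tangentPart, map_sub]
  abel

/-! ### Gradients -/

omit [T2Space M] [IsManifold (𝓡 n) ∞ M] in
theorem grad_spec (hf : IsSmoothImmersion (n := n) f) (u : M → ℝ) (x : M)
    (w : TangentSpace (𝓡 n) x) :
    inducedMetric f x (grad (n := n) (inducedMetric f) u x) w = mvfderiv (𝓡 n) u x w :=
  Classical.epsilon_spec (p := fun v => ∀ w, inducedMetric f x v w = mvfderiv (𝓡 n) u x w)
    (hf.exists_dual x (mvfderiv (𝓡 n) u x).toLinearMap) w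

theorem isSmoothField_grad (hf : IsSmoothImmersion (n := n) f) {u : M → ℝ}
    (hu : ContMDiff (𝓡 n) 𝓘(ℝ) ∞ u) : IsSmoothField (grad (n := n) (inducedMetric f) u) := by
  refine isSmoothField_of_inner hf fun Y hY => ?_
  simp_rw [grad_spec hf]
  exact dirDeriv_contMDiff hY hu

/-- Both sides are values of Hess u, because ∇_X grad u is the tangential part of D_X f_* grad u.
Differentiating Y(u) = ⟨grad u, Y⟩ and antisymmetrising leaves only the bracket terms, which agree.
-/
theorem hessian_symm (hf : IsSmoothImmersion (n := n) f) {u : M → ℝ}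
    (hu : ContMDiff (𝓡 n) 𝓘(ℝ) ∞ u) {X Y : VField n M} (hX : IsSmoothField X)
    (hY : IsSmoothField Y) (x : M) :
    (inner ℝ (dirDeriv X (dirDeriv (grad (n := n) (inducedMetric f) u) f) x) (dirDeriv Y f x) : ℝ)
      = inner ℝ (dirDeriv Y (dirDeriv (grad (n := n) (inducedMetric f) u) f) x) (dirDeriv X f x) := by
  have hZ := isSmoothField_grad hf hu
  have e : ∀ {A B : VField n M}, IsSmoothField B → dirDeriv A (dirDeriv B u) x
      = inner ℝ (dirDeriv (grad (n := n) (inducedMetric f) u) f x) (dirDeriv A (dirDeriv B f) x)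
        + inner ℝ (dirDeriv A (dirDeriv (grad (n := n) (inducedMetric f) u) f) x) (dirDeriv B f x) := by
    intro A B hB
    rw [← dirDeriv_inner (hZ.push hf) (hB.push hf)]
    congr 1
    funext y
    exact (grad_spec hf u y (B y)).symm
  have h1 := bracket_dirDeriv (hX.mdifferentiableAt x) (hY.mdifferentiableAt x) hu
  rw [← grad_spec hf, inducedMetric_apply,
    bracket_dirDeriv (hX.mdifferentiableAt x) (hY.mdifferentiableAt x) hf.1, e hX, e hY,
    inner_sub_right] at h1
  change (inner ℝ (dirDeriv (grad (n := n) (inducedMetric f) u) f x) _ : ℝ)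
    - inner ℝ (dirDeriv (grad (n := n) (inducedMetric f) u) f x) _ = _ at h1
  linarith

end Curvature

/-! ### Projections onto a distribution and smoothness of the complement of E_η. -/

section Distributions

variable {n m : ℕ} {M : Type*} [TopologicalSpace M]
  [ChartedSpace (EuclideanSpace ℝ (Fin n)) M]
  {f : M → EuclideanSpace ℝ (Fin m)}

theorem inducedMetric_isRefl (x : M) : (inducedMetric (n := n) f x).IsRefl :=
  fun v w h => by rw [inducedMetric_symm, h]

theorem IsSmoothImmersion.nondegenerate (hf : IsSmoothImmersion (n := n) f) (x : M) :
    (inducedMetric (n := n) f x).Nondegenerate :=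
  ⟨fun _ hv => hf.eq_zero hv, fun v hv => hf.eq_zero fun w => by rw [inducedMetric_symm, hv]⟩

theorem IsSmoothImmersion.orth_orth (hf : IsSmoothImmersion (n := n) f)
    (D : TangentDistribution n M) (x : M) :
    orth (inducedMetric f) (orth (inducedMetric f) D) x = D x :=
  LinearMap.BilinForm.orthogonal_orthogonal (hf.nondegenerate x) (inducedMetric_isRefl x) (D x)

theorem mem_orth {g : MetricField n M} {D : TangentDistribution n M} {x : M}
    {v : TangentSpace (𝓡 n) x} : v ∈ orth g D x ↔ ∀ w ∈ D x, g x w v = 0 := Iff.rfl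

theorem component_spec {x : M} (W : Submodule ℝ (TangentSpace (𝓡 n) x))
    (v : TangentSpace (𝓡 n) x) :
    component (inducedMetric f) W v ∈ W ∧
      ∀ w ∈ W, inducedMetric f x (v - component (inducedMetric f) W v) w = 0 := by
  refine Classical.epsilon_spec (p := fun u => u ∈ W ∧ ∀ w ∈ W, inducedMetric f x (v - u) w = 0) ?_
  set K := W.map (mvfderiv (𝓡 n) f x).toLinearMap with hK
  obtain ⟨u, hu, hue⟩ := (Submodule.starProjection_apply_mem K (mvfderiv (𝓡 n) f x v))
  refine ⟨u, hu, fun w hw => ?_⟩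
  have hue' : mvfderiv (𝓡 n) f x u = K.starProjection (mvfderiv (𝓡 n) f x v) := hue
  rw [inducedMetric_apply, map_sub, hue']
  exact (Submodule.mem_orthogonal' _ _).1 (Submodule.sub_starProjection_mem_orthogonal _) _
    ⟨w, hw, rfl⟩

theorem component_eq_zero (hf : IsSmoothImmersion (n := n) f) {x : M}
    {W : Submodule ℝ (TangentSpace (𝓡 n) x)} {v : TangentSpace (𝓡 n) x}
    (hv : ∀ w ∈ W, inducedMetric f x v w = 0) : component (inducedMetric f) W v = 0 := by
  obtain ⟨h1, h2⟩ := component_spec (f := f) W v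
  by_contra h
  have h3 := h2 _ h1
  rw [map_sub, LinearMap.sub_apply, hv _ h1, zero_sub, neg_eq_zero] at h3
  exact (hf.inducedMetric_pos h).ne' h3

variable [IsManifold (𝓡 n) ∞ M]

/-- The projection to `D` is `V` minus its expansion in a frame of the complement, so no frame of
`D` itself is needed. -/
theorem isSmoothField_component (hf : IsSmoothImmersion (n := n) f) {D : TangentDistribution n M}
    (hD : ∀ x, ∃ k : ℕ, ∃ e : Fin k → VField n M, (∀ i, IsSmoothField (e i)) ∧
      ∀ᶠ y in 𝓝 x, (∀ i, e i y ∈ orth (inducedMetric f) D y) ∧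
        IsOrthonormalFor (inducedMetric f y) (fun i => e i y) ∧
        Module.finrank ℝ (orth (inducedMetric f) D y) = k)
    {V : VField n M} (hV : IsSmoothField V) :
    IsSmoothField (fun x => component (inducedMetric f) (D x) (V x)) := by
  refine isSmoothField_of_local fun x => ?_
  obtain ⟨k, e, hes, he⟩ := hD x
  refine ⟨_, hV.sub (IsSmoothField.sum (s := Finset.univ) fun i _ =>
    (hes i).smul (hf.contMDiff_inducedMetric hV (hes i))), ?_⟩
  filter_upwards [he] with y ⟨hy1, hy2, hy3⟩
  obtain ⟨h1, h2⟩ := component_spec (f := f) (D y) (V y)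
  have h4 : V y - component (inducedMetric f) (D y) (V y) ∈ orth (inducedMetric f) D y :=
    fun w hw => by
      change inducedMetric f y w _ = 0
      rw [inducedMetric_symm, h2 w hw]
  have h5 := hy2.expand hy1 hy3 h4
  have h6 : ∀ i, inducedMetric f y (V y - component (inducedMetric f) (D y) (V y)) (e i y)
      = inducedMetric f y (V y) (e i y) := fun i => by
    rw [map_sub, LinearMap.sub_apply, mem_orth.1 (hy1 i) _ h1, sub_zero]
  simp_rw [h6] at h5
  rw [← h5, sub_sub_cancel]

variable {η : M → EuclideanSpace ℝ (Fin m)}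

theorem mem_principalDistribution {x : M} {v : TangentSpace (𝓡 n) x} :
    v ∈ principalDistribution f η x ↔
      ∀ w, secondForm f x v w = inducedMetric f x v w • η x := Iff.rfl

variable [T2Space M]

/-- For a field `W` and a constant vector `ν`, the dual of v ↦ ⟨α(v, W) - ⟨v, W⟩η, ν⟩ is smooth and
orthogonal to E_η. Anything orthogonal to all these duals at `x` lies in E_η, so they span the
complement there. -/
theorem exists_orth_principal_section (hf : IsSmoothImmersion (n := n) f)
    (hη : ContMDiff (𝓡 n) (𝓡 m) ∞ η) (x : M) (v : TangentSpace (𝓡 n) x)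
    (hv : v ∈ orth (inducedMetric f) (principalDistribution f η) x) :
    ∃ W, IsSectionOf W (orth (inducedMetric f) (principalDistribution f η)) ∧ W x = v := by
  let S : Submodule ℝ (TangentSpace (𝓡 n) x) :=
    { carrier := {v | ∃ W, IsSectionOf W (orth (inducedMetric f) (principalDistribution f η))
        ∧ W x = v}
      zero_mem' := ⟨0, ⟨isSmoothField_zero, fun y => Submodule.zero_mem _⟩, rfl⟩
      add_mem' := by
        rintro _ _ ⟨A, hA, rfl⟩ ⟨B, hB, rfl⟩
        exact ⟨_, ⟨hA.1.add hB.1, fun y => Submodule.add_mem _ (hA.2 y) (hB.2 y)⟩, rfl⟩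
      smul_mem' := by
        rintro c _ ⟨A, hA, rfl⟩
        exact ⟨_, ⟨hA.1.smul (contMDiff_const (c := c)),
          fun y => Submodule.smul_mem _ _ (hA.2 y)⟩, rfl⟩ }
  suffices h : (inducedMetric f x).orthogonal S ≤ principalDistribution f η x by
    have h2 := LinearMap.BilinForm.orthogonal_le (B := inducedMetric f x) h hv
    rwa [LinearMap.BilinForm.orthogonal_orthogonal (hf.nondegenerate x)
      (inducedMetric_isRefl x)] at h2
  intro u hu
  rw [mem_principalDistribution]
  intro w
  refine ext_inner_right ℝ fun ν => ?_
  obtain ⟨W, hW, -, rfl⟩ := exists_smoothField x w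
  have hdual : ∀ y, ∃ V : TangentSpace (𝓡 n) y, ∀ v, inducedMetric f y V v
      = inner ℝ (secondForm f y v (W y) - inducedMetric f y v (W y) • η y) ν := by
    intro y
    obtain ⟨V, hV⟩ := hf.exists_dual y
      (((innerₗ (EuclideanSpace ℝ (Fin m))).flip ν).comp ((secondFormBilin hf y).flip (W y)
        - ((inducedMetric f y).flip (W y)).smulRight (η y)))
    exact ⟨V, fun v => by rw [hV]; rfl⟩
  choose V hV using hdual
  have hVs : IsSectionOf V (orth (inducedMetric f) (principalDistribution f η)) := by
    refine ⟨isSmoothField_of_inner hf fun Y hY => ?_, fun y a ha => ?_⟩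
    · simp_rw [hV]
      exact contMDiff_inner ((contMDiff_secondForm hf hY hW).sub
        ((hf.contMDiff_inducedMetric hY hW).smul hη)) contMDiff_const
    · change inducedMetric f y a (V y) = 0
      rw [inducedMetric_symm, hV, mem_principalDistribution.1 ha, sub_self, inner_zero_left]
  have h1 : inducedMetric f x (V x) u = 0 := hu (V x) ⟨V, hVs, rfl⟩
  rwa [hV, inner_sub_left, sub_eq_zero] at h1

theorem exists_orth_principal_frame (hf : IsSmoothImmersion (n := n) f)
    (hη : ContMDiff (𝓡 n) (𝓡 m) ∞ η) {s : ℕ}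
    (hs : ∀ x, Module.finrank ℝ (principalDistribution (n := n) f η x) = s) (x : M) :
    ∃ e : Fin (n - s) → VField n M, (∀ i, IsSmoothField (e i)) ∧
      ∀ᶠ y in 𝓝 x, (∀ i, e i y ∈ orth (inducedMetric f) (principalDistribution f η) y) ∧
        IsOrthonormalFor (inducedMetric f y) (fun i => e i y) ∧
        Module.finrank ℝ (orth (n := n) (inducedMetric f) (principalDistribution f η) y)
          = n - s := by
  have hr : ∀ y : M,
      Module.finrank ℝ (orth (n := n) (inducedMetric f) (principalDistribution f η) y)
      = n - s := fun y => by
    rw [orth, LinearMap.BilinForm.finrank_orthogonal (hf.nondegenerate y), hs,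
      finrank_tangentSpace]
  obtain ⟨e, he1, he2⟩ := exists_orthonormal_sections hf
    (orth (inducedMetric f) (principalDistribution f η)) x (fun v hv => by
      obtain ⟨W, hW, h⟩ := exists_orth_principal_section hf hη x v hv
      exact ⟨W, hW.1, Filter.Eventually.of_forall hW.2, h⟩) (n - s) (hr x).ge
  exact ⟨e, he1, he2.mono fun y hy => ⟨hy.1, hy.2, hr y⟩⟩

theorem isSmoothDistribution_orth_principal (hf : IsSmoothImmersion (n := n) f)
    (hη : ContMDiff (𝓡 n) (𝓡 m) ∞ η) {s : ℕ}
    (hs : ∀ x, Module.finrank ℝ (principalDistribution (n := n) f η x) = s) :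
    IsSmoothDistribution (orth (inducedMetric f) (principalDistribution (n := n) f η)) := by
  refine ⟨n - s, fun x => ?_⟩
  obtain ⟨e, he1, he2⟩ := exists_orth_principal_frame hf hη hs x
  exact ⟨e, he1, he2.mono fun y hy => ⟨hy.2.1.linearIndependent, hy.2.1.span_eq hy.1 hy.2.2⟩⟩

end Distributions

/-! ### Smoothness of ℋ and ‖α‖², positivity and smoothness of ρ. -/

section Moebius

variable {n m : ℕ} {M : Type*} [TopologicalSpace M]
  [ChartedSpace (EuclideanSpace ℝ (Fin n)) M] [IsManifold (𝓡 n) ∞ M] [T2Space M]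
  {f : M → EuclideanSpace ℝ (Fin m)}

theorem meanCurvature_eq (hf : IsSmoothImmersion (n := n) f) {x : M}
    {e : Fin n → TangentSpace (𝓡 n) x} (he : IsOrthonormalFor (inducedMetric f x) e) :
    meanCurvature (n := n) f x = (n : ℝ)⁻¹ • ∑ i, secondForm f x (e i) (e i) := by
  rw [meanCurvature]
  congr 1
  exact sum_diagonal_eq (inducedMetric_symm (f := f) x) (finrank_tangentSpace x)
    (orthonormalFrame_spec hf x) he (secondFormBilin hf x)

theorem secondFormNormSq_eq (hf : IsSmoothImmersion (n := n) f) {x : M}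
    {e : Fin n → TangentSpace (𝓡 n) x} (he : IsOrthonormalFor (inducedMetric f x) e) :
    secondFormNormSq (n := n) f x = ∑ i, ∑ j, ‖secondForm f x (e i) (e j)‖ ^ 2 := by
  have key : ∀ (w : TangentSpace (𝓡 n) x) {a b : Fin n → TangentSpace (𝓡 n) x},
      IsOrthonormalFor (inducedMetric f x) a → IsOrthonormalFor (inducedMetric f x) b →
      ∑ i, ‖secondForm f x (a i) w‖ ^ 2 = ∑ i, ‖secondForm f x (b i) w‖ ^ 2 := by
    intro w a b ha hb
    have := sum_diagonal_eq (inducedMetric_symm (f := f) x) (finrank_tangentSpace x) ha hb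
      ((innerₗ (EuclideanSpace ℝ (Fin m))).compl₁₂ ((secondFormBilin hf x).flip w)
        ((secondFormBilin hf x).flip w))
    simpa [real_inner_self_eq_norm_sq] using this
  have ho := orthonormalFrame_spec hf x
  rw [secondFormNormSq, Finset.sum_comm]
  simp_rw [key _ ho he]
  rw [Finset.sum_comm]
  refine Finset.sum_congr rfl fun i _ => ?_
  simp_rw [secondForm_symm hf x (e i)]
  exact key _ ho he

theorem contMDiff_meanCurvature (hf : IsSmoothImmersion (n := n) f) :
    ContMDiff (𝓡 n) (𝓡 m) ∞ (meanCurvature (n := n) f) := by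
  refine contMDiff_of_local fun x => ?_
  obtain ⟨e, hes, he⟩ := exists_orthonormal_frame hf x
  refine ⟨fun y => (n : ℝ)⁻¹ • ∑ i, secondForm f y (e i y) (e i y), ?_,
    he.mono fun y hy => meanCurvature_eq hf hy⟩
  exact (contMDiff_const (I := 𝓡 n) (I' := 𝓘(ℝ)) (c := (n : ℝ)⁻¹)).smul
    (contMDiff_finsetSum fun i _ => contMDiff_secondForm hf (hes i) (hes i))

theorem contMDiff_secondFormNormSq (hf : IsSmoothImmersion (n := n) f) :
    ContMDiff (𝓡 n) 𝓘(ℝ) ∞ (secondFormNormSq (n := n) f) := by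
  refine contMDiff_of_local fun x => ?_
  obtain ⟨e, hes, he⟩ := exists_orthonormal_frame hf x
  refine ⟨fun y => ∑ i, ∑ j, ‖secondForm f y (e i y) (e j y)‖ ^ 2, ?_,
    he.mono fun y hy => secondFormNormSq_eq hf hy⟩
  simp_rw [← real_inner_self_eq_norm_sq]
  exact contMDiff_finsetSum fun i _ => contMDiff_finsetSum fun j _ =>
    contMDiff_inner (contMDiff_secondForm hf (hes i) (hes j))
      (contMDiff_secondForm hf (hes i) (hes j))

omit [T2Space M] in
theorem meanCurvature_mem (x : M) :
    meanCurvature (n := n) f x ∈ normalSpace (n := n) f x :=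
  Submodule.smul_mem _ _ (Submodule.sum_mem _ fun _ _ => secondForm_mem x _ _)

/-- `‖α‖² - n‖ℋ‖²` is the squared norm of the traceless part of `α`. -/
theorem sum_traceless (hf : IsSmoothImmersion (n := n) f) (hn : n ≠ 0) (x : M)
    {e : Fin n → TangentSpace (𝓡 n) x} (he : IsOrthonormalFor (inducedMetric f x) e) :
    secondFormNormSq (n := n) f x - n * ‖meanCurvature (n := n) f x‖ ^ 2
      = ∑ i, ∑ j, ‖secondForm f x (e i) (e j)
          - inducedMetric f x (e i) (e j) • meanCurvature (n := n) f x‖ ^ 2 := by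
  set H := meanCurvature (n := n) f x with hH
  have hsum : ∑ i, secondForm f x (e i) (e i) = (n : ℝ) • H := by
    rw [hH, meanCurvature_eq hf he, smul_smul, mul_inv_cancel₀ (by exact_mod_cast hn), one_smul]
  have h1 : ∀ i, ∑ j, ‖secondForm f x (e i) (e j) - inducedMetric f x (e i) (e j) • H‖ ^ 2
      = ∑ j, ‖secondForm f x (e i) (e j)‖ ^ 2
        - 2 * inner ℝ (secondForm f x (e i) (e i)) H + ‖H‖ ^ 2 := by
    intro i
    have : ∀ j, ‖secondForm f x (e i) (e j) - inducedMetric f x (e i) (e j) • H‖ ^ 2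
        = ‖secondForm f x (e i) (e j)‖ ^ 2
          + if i = j then - 2 * inner ℝ (secondForm f x (e i) (e j)) H + ‖H‖ ^ 2 else 0 := by
      intro j
      rw [he i j]
      split_ifs with h
      · rw [one_smul, norm_sub_sq_real]; ring
      · simp
    simp_rw [this, Finset.sum_add_distrib]
    simp
    ring
  simp_rw [h1, Finset.sum_add_distrib, Finset.sum_sub_distrib, ← Finset.mul_sum, ← sum_inner]
  rw [hsum, secondFormNormSq_eq hf he, real_inner_smul_left, real_inner_self_eq_norm_sq]
  simp
  ring

theorem secondForm_eq_of_umbilic (hf : IsSmoothImmersion (n := n) f) (hn : n ≠ 0) (x : M)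
    (h : secondFormNormSq (n := n) f x - n * ‖meanCurvature (n := n) f x‖ ^ 2 ≤ 0)
    (v w : TangentSpace (𝓡 n) x) :
    secondForm f x v w = inducedMetric f x v w • meanCurvature (n := n) f x := by
  have he := orthonormalFrame_spec hf x
  rw [sum_traceless hf hn x he] at h
  have h0 := le_antisymm h (Finset.sum_nonneg fun i _ => Finset.sum_nonneg fun j _ => sq_nonneg _)
  set e := orthonormalFrame (n := n) (inducedMetric f) x
  have h1 : ∀ i j, secondForm f x (e i) (e j)
      = inducedMetric f x (e i) (e j) • meanCurvature (n := n) f x := by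
    intro i j
    have h2 := (Finset.sum_eq_zero_iff_of_nonneg
      (fun i _ => Finset.sum_nonneg fun j _ => sq_nonneg _)).1 h0 i (Finset.mem_univ i)
    have h3 := (Finset.sum_eq_zero_iff_of_nonneg (fun j _ => sq_nonneg _)).1 h2 j
      (Finset.mem_univ j)
    rwa [sq_eq_zero_iff, norm_eq_zero, sub_eq_zero] at h3
  have key : secondFormBilin hf x
      = (inducedMetric f x).compr₂ (LinearMap.toSpanSingleton ℝ _ (meanCurvature (n := n) f x)) := by
    have hb := he.linearIndependent
    have hspan : ⊤ ≤ Submodule.span ℝ (Set.range e) :=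
      (he.span_eq (S := ⊤) (by simp) (by simp [finrank_tangentSpace])).ge
    exact LinearMap.ext_basis (Module.Basis.mk hb hspan) (Module.Basis.mk hb hspan) fun i j => by
      simpa using h1 i j
  exact congrArg (fun B => B v w) key

variable {η : M → EuclideanSpace ℝ (Fin m)}

/-- At an umbilical point α = ⟨ , ⟩ℋ. A nonzero vector of E_η then forces η = ℋ, so E_η would be the
whole tangent space, against s < n. -/
theorem traceless_pos (hf : IsSmoothImmersion (n := n) f) {s : ℕ} (hs0 : 0 < s) (hsn : s < n)
    (hs : ∀ x, Module.finrank ℝ (principalDistribution (n := n) f η x) = s) (x : M) :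
    0 < secondFormNormSq (n := n) f x - n * ‖meanCurvature (n := n) f x‖ ^ 2 := by
  by_contra! h
  have hα := secondForm_eq_of_umbilic hf (by omega) x h
  have hne : principalDistribution (n := n) f η x ≠ ⊥ := by
    intro hb
    have := hs x
    rw [hb, finrank_bot] at this
    omega
  obtain ⟨v, hv, hv0⟩ := Submodule.exists_mem_ne_zero_of_ne_bot hne
  have h1 : inducedMetric f x v v • (meanCurvature (n := n) f x - η x) = 0 := by
    rw [smul_sub, ← hα, ← mem_principalDistribution.1 hv, sub_self]
  have h2 : meanCurvature (n := n) f x = η x := by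
    rcases smul_eq_zero.1 h1 with h | h
    · exact absurd h (hf.inducedMetric_pos hv0).ne'
    · exact sub_eq_zero.1 h
  have h3 : principalDistribution (n := n) f η x = ⊤ := by
    rw [eq_top_iff]
    intro w _
    rw [mem_principalDistribution]
    intro w'
    rw [hα, h2]
  have := hs x
  rw [h3, finrank_top, finrank_tangentSpace] at this
  omega

theorem moebiusFactor_pos (hf : IsSmoothImmersion (n := n) f) {s : ℕ} (hs0 : 0 < s) (hsn : s < n)
    (hs : ∀ x, Module.finrank ℝ (principalDistribution (n := n) f η x) = s) (x : M) :
    0 < moebiusFactor (n := n) f x := by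
  have h := traceless_pos hf hs0 hsn hs x
  have hn : (1 : ℝ) < n := by exact_mod_cast (by omega : 1 < n)
  exact Real.sqrt_pos.2 (mul_pos (div_pos (by linarith) (by linarith)) h)

theorem contMDiff_moebiusFactor (hf : IsSmoothImmersion (n := n) f)
    (hpos : ∀ x, 0 < moebiusFactor (n := n) f x) :
    ContMDiff (𝓡 n) 𝓘(ℝ) ∞ (moebiusFactor (n := n) f) := by
  have h1 : ContMDiff (𝓡 n) 𝓘(ℝ) ∞ (fun x => (n : ℝ) / ((n : ℝ) - 1) *
      (secondFormNormSq (n := n) f x - (n : ℝ) * ‖meanCurvature (n := n) f x‖ ^ 2)) := by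
    simp_rw [← real_inner_self_eq_norm_sq]
    have hH := contMDiff_meanCurvature hf
    exact contMDiff_const.mul ((contMDiff_secondFormNormSq hf).sub
      (contMDiff_const.mul (contMDiff_inner hH hH)))
  intro x
  exact (Real.contDiffAt_sqrt (Real.sqrt_pos.1 (hpos x)).ne').contMDiffAt.comp x (h1 x)

end Moebius

/-! ### The Moebius form, the Hessian of 1/ρ and sphericity. -/

section MoebiusForm

variable {n m : ℕ} {M : Type*} [TopologicalSpace M]
  [ChartedSpace (EuclideanSpace ℝ (Fin n)) M] [IsManifold (𝓡 n) ∞ M]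
  {f : M → EuclideanSpace ℝ (Fin m)}

/-- The function `1/ρ`. -/
noncomputable def inverseFactor (n : ℕ) {m : ℕ} {M : Type*} [TopologicalSpace M]
    [ChartedSpace (EuclideanSpace ℝ (Fin n)) M] [IsManifold (𝓡 n) ∞ M]
    (f : M → EuclideanSpace ℝ (Fin m)) (x : M) : ℝ := (moebiusFactor (n := n) f x)⁻¹

variable [T2Space M]

theorem contMDiff_inverseFactor (hf : IsSmoothImmersion (n := n) f)
    (hpos : ∀ x, 0 < moebiusFactor (n := n) f x) :
    ContMDiff (𝓡 n) 𝓘(ℝ) ∞ (inverseFactor n f) := fun x =>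
  ((contDiffAt_inv ℝ (hpos x).ne').contMDiffAt.comp x (contMDiff_moebiusFactor hf hpos x))

theorem mvfderiv_inverseFactor (hf : IsSmoothImmersion (n := n) f)
    (hpos : ∀ x, 0 < moebiusFactor (n := n) f x) (x : M) (v : TangentSpace (𝓡 n) x) :
    mvfderiv (𝓡 n) (inverseFactor n f) x v
      = -(moebiusFactor (n := n) f x ^ 2)⁻¹ * mvfderiv (𝓡 n) (moebiusFactor (n := n) f) x v :=
  mvfderiv_comp_real (hasDerivAt_inv (hpos x).ne') ((contMDiff_moebiusFactor hf hpos).mdiffAt x) v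

theorem mvfderiv_log_moebiusFactor (hf : IsSmoothImmersion (n := n) f)
    (hpos : ∀ x, 0 < moebiusFactor (n := n) f x) (x : M) (v : TangentSpace (𝓡 n) x) :
    mvfderiv (𝓡 n) (fun y => Real.log (moebiusFactor (n := n) f y)) x v
      = (moebiusFactor (n := n) f x)⁻¹ * mvfderiv (𝓡 n) (moebiusFactor (n := n) f) x v :=
  mvfderiv_comp_real (Real.hasDerivAt_log (hpos x).ne')
    ((contMDiff_moebiusFactor hf hpos).mdiffAt x) v

theorem grad_moebiusMetric (hf : IsSmoothImmersion (n := n) f)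
    (hpos : ∀ x, 0 < moebiusFactor (n := n) f x) (x : M) :
    grad (n := n) (moebiusMetric f) (moebiusFactor (n := n) f) x
      = -grad (n := n) (inducedMetric f) (inverseFactor n f) x := by
  have h0 := (hpos x).ne'
  have h1 : ∀ w, moebiusMetric f x (-grad (n := n) (inducedMetric f) (inverseFactor n f) x) w
      = mvfderiv (𝓡 n) (moebiusFactor (n := n) f) x w := by
    intro w
    rw [moebiusMetric, map_neg, LinearMap.neg_apply, LinearMap.smul_apply, LinearMap.smul_apply,
      grad_spec hf, mvfderiv_inverseFactor hf hpos, smul_eq_mul]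
    field_simp
  have h2 := Classical.epsilon_spec (p := fun v => ∀ w, moebiusMetric f x v w
    = mvfderiv (𝓡 n) (moebiusFactor (n := n) f) x w) ⟨_, h1⟩
  refine hf.eq_of_forall fun w => ?_
  have h3 := (h2 w).trans (h1 w).symm
  simp only [moebiusMetric, LinearMap.smul_apply, smul_eq_mul] at h3
  exact mul_left_cancel₀ (pow_ne_zero 2 h0) h3

/-- The Moebius form is the normal derivative of `f_* grad (1/ρ) - ℋ/ρ`. -/
theorem moebiusForm_eq (hf : IsSmoothImmersion (n := n) f)
    (hpos : ∀ x, 0 < moebiusFactor (n := n) f x) (X : VField n M) :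
    moebiusForm f X = normalConnection f X (fun y =>
      dirDeriv (grad (n := n) (inducedMetric f) (inverseFactor n f)) f y
        - inverseFactor n f y • meanCurvature (n := n) f y) := by
  funext x
  have h0 := (hpos x).ne'
  have hφ := contMDiff_inverseFactor hf hpos
  have hH := contMDiff_meanCurvature hf
  have hZ := isSmoothField_grad hf hφ
  have hS : ContMDiff (𝓡 n) (𝓡 m) ∞
      (fun y => inverseFactor n f y • meanCurvature (n := n) f y) := hφ.smul hH
  have hd : dirDeriv X (fun y => dirDeriv (grad (n := n) (inducedMetric f) (inverseFactor n f)) f y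
        - inverseFactor n f y • meanCurvature (n := n) f y) x
      = mvfderiv (𝓡 n) (dirDeriv (grad (n := n) (inducedMetric f) (inverseFactor n f)) f) x (X x)
        - (inverseFactor n f x • dirDeriv X (meanCurvature (n := n) f) x
          + mvfderiv (𝓡 n) (inverseFactor n f) x (X x) • meanCurvature (n := n) f x) := by
    rw [dirDeriv, mvfderiv_fun_sub ((hZ.push hf).mdiffAt x) (hS.mdiffAt x),
      mvfderiv_fun_smul (hφ.mdiffAt x) (hH.mdiffAt x)]
    rfl
  have hN : (normalSpace (n := n) f x).starProjection (meanCurvature (n := n) f x)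
      = meanCurvature (n := n) f x :=
    Submodule.starProjection_eq_self_iff.2 (meanCurvature_mem x)
  have hneg : ∀ v w : TangentSpace (𝓡 n) x, secondForm f x v (-w) = -secondForm f x v w :=
    fun v w => (secondFormBilin hf x v).map_neg w
  -- The normal part of D_X f_* grad φ is α(X, grad φ), which accounts for the α-part of β(X, grad*
  -- ρ); X(φ)ℋ accounts for its trace part.
  rw [normalConnection, hd, map_sub, map_add, map_smul, map_smul, hN, ← secondForm_eq hf hZ,
    moebiusForm, grad_moebiusMetric hf hpos, moebiusSecondForm, hneg, map_neg, inducedMetric_symm,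
    grad_spec hf]
  simp only [normalConnection, inverseFactor, smul_add, smul_sub, smul_neg, neg_smul, smul_smul,
    inv_mul_cancel₀ h0, ← mul_assoc, one_smul, one_mul]
  abel

/-- Closedness of the Moebius form over a flat normal bundle: the Hessian of `1/ρ` commutes with
the second fundamental form. -/
theorem secondForm_hessian_comm (hf : IsSmoothImmersion (n := n) f)
    (hpos : ∀ x, 0 < moebiusFactor (n := n) f x) (hflat : HasFlatNormalBundle (n := n) f)
    (hclosed : HasClosedMoebiusForm (n := n) f) {X Y : VField n M} (hX : IsSmoothField X)
    (hY : IsSmoothField Y) (x : M) :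
    secondForm f x (Y x) (tangentPart f x
        (dirDeriv X (dirDeriv (grad (n := n) (inducedMetric f) (inverseFactor n f)) f) x))
      = secondForm f x (X x) (tangentPart f x
        (dirDeriv Y (dirDeriv (grad (n := n) (inducedMetric f) (inverseFactor n f)) f) x)) := by
  have hφ := contMDiff_inverseFactor hf hpos
  have hH := contMDiff_meanCurvature hf
  have hF := (isSmoothField_grad hf hφ).push hf
  have hS : ContMDiff (𝓡 n) (𝓡 m) ∞
      (fun y => inverseFactor n f y • meanCurvature (n := n) f y) := hφ.smul hH
  have hG := hF.sub hS
  have h1 := hclosed X Y hX hY x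
  simp_rw [moebiusForm_eq hf hpos] at h1
  -- The commutator formula is used twice: for the non-normal map G by closedness, and for its
  -- summand φℋ by flatness.
  have h1' := (normalConnection_curvature hf hX hY hG x).symm.trans h1
  have h2' := (normalConnection_curvature hf hX hY hS x).symm.trans
    (hflat X Y _ hX hY ⟨hS, fun y => Submodule.smul_mem _ _ (meanCurvature_mem y)⟩ x)
  have hd : ∀ A : VField n M, dirDeriv A (fun y =>
      dirDeriv (grad (n := n) (inducedMetric f) (inverseFactor n f)) f y
        - inverseFactor n f y • meanCurvature (n := n) f y) x
      = dirDeriv A (dirDeriv (grad (n := n) (inducedMetric f) (inverseFactor n f)) f) x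
        - dirDeriv A (fun y => inverseFactor n f y • meanCurvature (n := n) f y) x := by
    intro A
    rw [dirDeriv, mvfderiv_fun_sub (hF.mdiffAt x) (hS.mdiffAt x)]
    rfl
  have hsub : ∀ v w w' : TangentSpace (𝓡 n) x,
      secondForm f x v (w - w') = secondForm f x v w - secondForm f x v w' :=
    fun v w w' => (secondFormBilin hf x v).map_sub w w'
  change secondForm f x (Y x) (tangentPart f x (dirDeriv X (fun y =>
      dirDeriv (grad (n := n) (inducedMetric f) (inverseFactor n f)) f y
        - inverseFactor n f y • meanCurvature (n := n) f y) x))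
    - secondForm f x (X x) (tangentPart f x (dirDeriv Y (fun y =>
      dirDeriv (grad (n := n) (inducedMetric f) (inverseFactor n f)) f y
        - inverseFactor n f y • meanCurvature (n := n) f y) x)) = 0 at h1'
  rwa [hd, hd, tangentPart_sub hf, tangentPart_sub hf, hsub, hsub, sub_eq_zero.1 h2',
    sub_sub_sub_cancel_right, sub_eq_zero] at h1'

variable {η : M → EuclideanSpace ℝ (Fin m)}

/-- The Hessian of `1/ρ` preserves `E_η`. -/
theorem hessian_mem_principal (hf : IsSmoothImmersion (n := n) f)
    (hpos : ∀ x, 0 < moebiusFactor (n := n) f x) (hflat : HasFlatNormalBundle (n := n) f)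
    (hclosed : HasClosedMoebiusForm (n := n) f) {X : VField n M} (hX : IsSmoothField X) {x : M}
    (hXx : X x ∈ principalDistribution (n := n) f η x) :
    tangentPart f x (dirDeriv X (dirDeriv (grad (n := n) (inducedMetric f) (inverseFactor n f)) f) x)
      ∈ principalDistribution (n := n) f η x := by
  rw [mem_principalDistribution]
  intro w
  obtain ⟨W, hW, -, rfl⟩ := exists_smoothField x w
  -- α(∇_X grad φ, W) = α(X, ∇_W grad φ) = ⟨X, ∇_W grad φ⟩η, and symmetry of the Hessian moves the
  -- derivative back to X.
  rw [secondForm_symm hf, secondForm_hessian_comm hf hpos hflat hclosed hX hW,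
    mem_principalDistribution.1 hXx, inducedMetric_symm, inducedMetric_tangentPart,
    inducedMetric_tangentPart]
  exact congrArg (fun c : ℝ => c • η x)
    (hessian_symm hf (contMDiff_inverseFactor hf hpos) hW hX x)

omit [T2Space M] in
theorem mem_orth_moebiusMetric (hpos : ∀ x, 0 < moebiusFactor (n := n) f x)
    {E : TangentDistribution n M} {x : M} {v : TangentSpace (𝓡 n) x} :
    v ∈ orth (moebiusMetric f) E x ↔ v ∈ orth (inducedMetric f) E x := by
  simp only [mem_orth, moebiusMetric, LinearMap.smul_apply, smul_eq_mul, mul_eq_zero,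
    pow_eq_zero_iff, (hpos x).ne', ne_eq, OfNat.ofNat_ne_zero, not_false_eq_true, false_or]

/-- A distribution that is totally geodesic for the Moebius metric is umbilical for the induced
metric. -/
theorem umbilical_of_totallyGeodesic (hf : IsSmoothImmersion (n := n) f)
    (hpos : ∀ x, 0 < moebiusFactor (n := n) f x) {E : TangentDistribution n M}
    (hgeod : IsTotallyGeodesic (moebiusMetric f) E) {T S X : VField n M} (hT : IsSectionOf T E)
    (hS : IsSectionOf S E) (hX : IsSectionOf X (orth (inducedMetric f) E)) (x : M) :
    (inner ℝ (dirDeriv T (dirDeriv S f) x) (dirDeriv X f x) : ℝ)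
      = inducedMetric f x (T x) (S x)
        * mvfderiv (𝓡 n) (fun y => Real.log (moebiusFactor (n := n) f y)) x (X x) := by
  have hρ := contMDiff_moebiusFactor hf hpos
  have hXs : IsSectionOf X (orth (moebiusMetric f) E) :=
    ⟨hX.1, fun y => (mem_orth_moebiusMetric hpos).2 (hX.2 y)⟩
  have h1 := hgeod.2 T S X hT hS hXs x
  have h2 := leviCivita_conformal hf (hρ.pow 2) (fun y => pow_ne_zero 2 (hpos y).ne') hT.1 hS.1
    hX.1 x
  have h3 : ∀ {A : VField n M}, IsSectionOf A E → inducedMetric f x (A x) (X x) = 0 :=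
    fun hA => mem_orth.1 (hX.2 x) _ (hA.2 x)
  have h4 : moebiusFactor (n := n) f x ^ 2 * inducedMetric f x
      (leviCivita (fun y => moebiusFactor (n := n) f y ^ 2 • inducedMetric f y) T S x) (X x)
      = 0 := by
    refine h1.trans ?_
    simp
  have h5 : mvfderiv (𝓡 n) (fun y => moebiusFactor (n := n) f y ^ 2) x (X x)
      = 2 * moebiusFactor (n := n) f x * mvfderiv (𝓡 n) (moebiusFactor (n := n) f) x (X x) := by
    have := mvfderiv_comp_real (hasDerivAt_pow 2 (moebiusFactor (n := n) f x)) (hρ.mdiffAt x) (X x)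
    simpa using this
  -- As X is orthogonal to T and S, the only conformal correction left is -X(ρ²)⟨T, S⟩.
  rw [h4, h3 hT, h3 hS, h5] at h2
  rw [mvfderiv_log_moebiusFactor hf hpos]
  have h0 := (hpos x).ne'
  field_simp
  refine mul_left_cancel₀ (mul_ne_zero two_ne_zero h0) ?_
  linarith

theorem isSpherical_orth_principal (hf : IsSmoothImmersion (n := n) f)
    (hpos : ∀ x, 0 < moebiusFactor (n := n) f x) (hflat : HasFlatNormalBundle (n := n) f)
    (hclosed : HasClosedMoebiusForm (n := n) f) (hη : ContMDiff (𝓡 n) (𝓡 m) ∞ η) {s : ℕ}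
    (hs : ∀ x, Module.finrank ℝ (principalDistribution (n := n) f η x) = s)
    (hgeod : IsTotallyGeodesic (moebiusMetric f)
      (orth (inducedMetric f) (principalDistribution (n := n) f η))) :
    IsSphericalWith (inducedMetric f) (orth (inducedMetric f) (principalDistribution (n := n) f η))
      (fun x => component (inducedMetric f) (principalDistribution f η x)
        (grad (n := n) (inducedMetric f) (fun y => Real.log (moebiusFactor (n := n) f y)) x)) := by
  set Δ := principalDistribution (n := n) f η
  set u : M → ℝ := fun y => Real.log (moebiusFactor (n := n) f y) with hu
  set φ := inverseFactor n f with hφdef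
  have hρ := contMDiff_moebiusFactor hf hpos
  have hφ := contMDiff_inverseFactor hf hpos
  have hus : ContMDiff (𝓡 n) 𝓘(ℝ) ∞ u := fun x =>
    (Real.contDiffAt_log.2 (hpos x).ne').contMDiffAt.comp x (hρ x)
  have hcomp : ∀ {V : VField n M}, IsSmoothField V →
      IsSectionOf (fun x => component (inducedMetric f) (Δ x) (V x)) Δ := fun hV =>
    ⟨isSmoothField_component hf (fun x => ⟨_, exists_orth_principal_frame hf hη hs x⟩) hV,
      fun x => (component_spec (f := f) (Δ x) _).1⟩
  set δ : VField n M := fun x => component (inducedMetric f) (Δ x)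
    (grad (n := n) (inducedMetric f) u x)
  have hδ : IsSectionOf δ Δ := hcomp (isSmoothField_grad hf hus)
  have hδg : ∀ x, ∀ w ∈ Δ x, inducedMetric f x (δ x) w = mvfderiv (𝓡 n) u x w := by
    intro x w hw
    have h := (component_spec (f := f) (Δ x) (grad (n := n) (inducedMetric f) u x)).2 w hw
    rw [map_sub, LinearMap.sub_apply, sub_eq_zero, grad_spec hf] at h
    exact h.symm
  have hoo : ∀ {X : VField n M}, IsSectionOf X (orth (inducedMetric f) (orth (inducedMetric f) Δ))
      ↔ IsSectionOf X Δ := by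
    intro X
    simp only [IsSectionOf, hf.orth_orth]
  have humb : ∀ {T S X : VField n M}, IsSectionOf T (orth (inducedMetric f) Δ) →
      IsSectionOf S (orth (inducedMetric f) Δ) → IsSectionOf X Δ → ∀ x,
      (inner ℝ (dirDeriv T (dirDeriv S f) x) (dirDeriv X f x) : ℝ)
        = inducedMetric f x (T x) (S x) * mvfderiv (𝓡 n) u x (X x) := fun hT hS hX =>
    umbilical_of_totallyGeodesic hf hpos hgeod hT hS (hoo.2 hX)
  refine ⟨⟨hoo.2 hδ, fun T S X hT hS hX x => ?_⟩, fun T hT x => ?_⟩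
  · rw [hoo] at hX
    rw [inducedMetric_leviCivita hf hT.1 hS.1, hδg x _ (hX.2 x)]
    exact humb hT hS hX x
  refine component_eq_zero hf fun w hw => ?_
  rw [hf.orth_orth] at hw
  rw [inducedMetric_leviCivita hf hT.1 hδ.1]
  -- An arbitrary smooth extension of `w`, projected to Δ, still takes the value `w` at `x`.
  obtain ⟨W, hW, hWx⟩ : ∃ W, IsSectionOf W Δ ∧ W x = w := by
    obtain ⟨W, hW, -, hWx⟩ := exists_smoothField x w
    refine ⟨_, hcomp hW, ?_⟩
    obtain ⟨h1, h2⟩ := component_spec (f := f) (Δ x) (W x)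
    rw [hWx] at h1 h2 ⊢
    by_contra hne
    have h4 := hf.inducedMetric_pos (sub_ne_zero.2 (Ne.symm hne))
    exact h4.ne' (h2 _ (Submodule.sub_mem _ hw h1))
  subst hWx
  have hZ := isSmoothField_grad hf hφ
  set Z : VField n M := grad (n := n) (inducedMetric f) φ with hZdef
  -- The Δ-component of grad φ = -φ grad log ρ is -φδ, so adding φδ removes it.
  have hZ' : IsSectionOf (fun y => Z y + φ y • δ y) (orth (inducedMetric f) Δ) := by
    refine ⟨hZ.add (hδ.1.smul hφ), fun y => mem_orth.2 fun a ha => ?_⟩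
    rw [inducedMetric_symm, map_add, map_smul, LinearMap.add_apply, LinearMap.smul_apply,
      hδg y a ha, hZdef, grad_spec hf, mvfderiv_inverseFactor hf hpos, hu,
      mvfderiv_log_moebiusFactor hf hpos, hφdef, inverseFactor, smul_eq_mul]
    have h0 := (hpos y).ne'
    field_simp
    ring
  have hess : (inner ℝ (dirDeriv T (dirDeriv Z f) x) (dirDeriv W f x) : ℝ) = 0 := by
    rw [hessian_symm hf hφ hT.1 hW.1]
    have h := mem_orth.1 (hT.2 x) _ (hessian_mem_principal hf hpos hflat hclosed hW.1 (hW.2 x))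
    rwa [inducedMetric_tangentPart] at h
  have hsum : dirDeriv T (dirDeriv (fun y => Z y + φ y • δ y) f) x
      = dirDeriv T (dirDeriv Z f) x + (φ x • dirDeriv T (dirDeriv δ f) x
        + mvfderiv (𝓡 n) φ x (T x) • dirDeriv δ f x) := by
    have h1 : dirDeriv (fun y => Z y + φ y • δ y) f
        = fun y => dirDeriv Z f y + φ y • dirDeriv δ f y := by
      funext y
      simp [dirDeriv]
    have hδF := hδ.1.push hf
    have hφδ : ContMDiff (𝓡 n) (𝓡 m) ∞ (fun y => φ y • dirDeriv δ f y) := hφ.smul hδF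
    rw [h1, dirDeriv, mvfderiv_fun_add ((hZ.push hf).mdiffAt x) (hφδ.mdiffAt x),
      mvfderiv_fun_smul (hφ.mdiffAt x) (hδF.mdiffAt x)]
    rfl
  -- Umbilicity for the pair T, grad φ + φδ; both sides contain T(φ)⟨δ, W⟩, which cancels.
  have h1 := humb hT hZ' hW x
  have h2 : inducedMetric f x (T x) (δ x) = 0 := by
    rw [inducedMetric_symm]
    exact mem_orth.1 (hT.2 x) _ (hδ.2 x)
  have h3 : inducedMetric f x (T x) (Z x) = mvfderiv (𝓡 n) φ x (T x) := by
    rw [inducedMetric_symm, grad_spec hf]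
  have h4 : (inner ℝ (dirDeriv δ f x) (dirDeriv W f x) : ℝ) = mvfderiv (𝓡 n) u x (W x) :=
    hδg x _ (hW.2 x)
  rw [hsum, inner_add_left, hess, inner_add_left, real_inner_smul_left, real_inner_smul_left, h4,
    map_add, map_smul, h2, h3, smul_zero, add_zero, zero_add, add_eq_right] at h1
  rcases mul_eq_zero.1 h1 with h | h
  · exact absurd h (inv_ne_zero (hpos x).ne')
  · exact h

end MoebiusForm

end MoebiusGeometry

theorem mainTheorem11 (n p l : ℕ) (hp : 1 ≤ p) (hnp : p + 3 ≤ n) (hl : l ≤ p - 1)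
    {M : Type*} [TopologicalSpace M] [T2Space M] [SecondCountableTopology M]
    [ChartedSpace (EuclideanSpace ℝ (Fin n)) M] [IsManifold (𝓡 n) ∞ M]
    (f : M → EuclideanSpace ℝ (Fin (n + p))) (hf : IsSmoothImmersion (n := n) f)
    (hflat : HasFlatNormalBundle (n := n) f) (hproper : IsProperImmersion (n := n) f)
    (hconf : IsConformallyFlat (n := n) (inducedMetric f))
    (hclosed : HasClosedMoebiusForm (n := n) f)
    (η : M → EuclideanSpace ℝ (Fin (n + p)))
    (hη : IsPrincipalNormalField (n := n) f η (n - p + l))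
    (Δ : TangentDistribution n M) (hΔ : Δ = principalDistribution f η)
    (hgeod : IsTotallyGeodesic (moebiusMetric f) (orth (inducedMetric f) Δ)) :
    IsSmoothDistribution (orth (inducedMetric f) Δ) ∧
      IsSphericalWith (inducedMetric f) (orth (inducedMetric f) Δ)
        (fun x => component (inducedMetric f) (Δ x)
          (grad (inducedMetric f) (fun y => Real.log (moebiusFactor (n := n) f y)) x)) := by
  subst hΔ
  -- From p ≥ 1 and l ≤ p - 1 the multiplicity n - p + l is less than n.
  have hpos := moebiusFactor_pos hf hη.2.1 (by omega) hη.2.2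
  exact ⟨isSmoothDistribution_orth_principal hf hη.1.1 hη.2.2,
    isSpherical_orth_principal hf hpos hflat hclosed hη.1.1 hη.2.2 hgeod⟩
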